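/- Let $\mathfrak g$ be a finite-dimensional complex simple Lie algebra with Cartan matrix $C=(c_{ij})_{i,j\in I}$, $c_{ij}=\langle\alpha_i^\vee,\alpha_j\rangle$ (with respect to some Cartan subalgebra and some choice of simple roots $\alpha_i$, $i\in I$). Let $d_i\in\{1,r\}$ be half the squared length of $\alpha_i$ for the invariant form normalized so that short roots have squared length $2$ (so $d_ic_{ij}=d_jc_{ji}$), where $r\in\{1,2,3\}$ is the ratio of the squared lengths of the longest and the shortest roots. Let $h^\vee=1+\langle\rho,\theta^\vee\rangle$ be the dual Coxeter number ($\theta$ the highest root), and let $i\mapsto i^*$ be the involution of $I$ given by $w_0\alpha_i=-\alpha_{i^*}$, where $w_0$ is the longest element of the Weyl group. Let $C(z)=(C_{ij}(z))_{i,j\in I}$ be the quantum Cartan matrix: $C_{ii}(z)=z^{d_i}+z^{-d_i}$, and $C_{ij}(z)=[c_{ij}]_z$ for $i\ne j$, where $[k]_z=\frac{z^k-z^{-k}}{z-z^{-1}}$. Then $C(z)$ is invertible over $\mathbb Q(z)$. Write $$(C(z)^{-1})_{ij}=\sum_{u\in\mathbb Z}\widetilde c_{ij}(u)z^u$$ for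 the Laurent expansion at $z=0$ of the entries of the inverse. The $\widetilde c_{ij}(u)$ ($i,j\in I$, $u\in\mathbb Z$) are integers, and they satisfy: 1. $\widetilde c_{ij}(u+rh^\vee)=-\widetilde c_{ij^*}(u)$ for $u\ge 0$; 2. $\widetilde c_{ij}(u+2rh^\vee)=\widetilde c_{ij}(u)$ for $u\ge 0$; 3. $\widetilde c_{ij}(rh^\vee-u)=\widetilde c_{ij^*}(u)$ for $0\le u\le rh^\vee$; 4. $\widetilde c_{ij}(2rh^\vee-u)=-\widetilde c_{ij}(u)$ for $0\le u\le 2rh^\vee$; 5. $\widetilde c_{ij}(u)=0$ if $|u-k\,rh^\vee|\le d_i-\delta_{i,j^{*k}}$ for some integer $k\ge 0$, where $j^{*k}=j$ if $k$ is even and $j^{*k}=j^*$ if $k$ is odd; 6. $\widetilde c_{ij}(u)\ge 0$ for $0\le u\le rh^\vee$; 7. $\widetilde c_{ij}(u)\le 0$ for $rh^\vee\le u\le 2rh^\vee$. -/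

import Mathlib

open scoped LaurentSeries

namespace QuantumCartan

noncomputable section

variable {ι K M N : Type*} [Fintype ι] [Field K] [CharZero K] [AddCommGroup M] [Module K M]
  [AddCommGroup N] [Module K N] {P : RootPairing ι K M N} [P.IsCrystallographic]

/-- The squared length `(α, α)` of a root, with respect to the canonical Weyl-invariant form
`(x, y) = ∑_β ⟨x, β^∨⟩ ⟨y, β^∨⟩`. -/
def sqLength (P : RootPairing ι K M N) [P.IsCrystallographic] (i : ι) : ℤ :=
  (P.posRootForm ℤ).rootLength i

/-- The squared length of a root divided by the squared length of a shortest root. For an irreducible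
root system this is the normalization in which short roots get the value `1`; on the simple roots
it gives the entries `d_i` of the standard symmetrizer of the Cartan matrix. The integer division
is exact for irreducible reduced root systems. -/
def symmetrizer (P : RootPairing ι K M N) [P.IsCrystallographic] (i : ι) : ℤ :=
  sqLength P i / sInf (Set.range (sqLength P))

/-- The lacing number `r`: the ratio of the squared lengths of a longest and a shortest root.
It is `1` for types ADE, `2` for types BCF and `3` for type G. -/
def lacingNumber (P : RootPairing ι K M N) [P.IsCrystallographic] : ℤ :=
  sSup (Set.range (symmetrizer P))

/-- The entry `c_ij = ⟨α_i^∨, α_j⟩` of the Cartan matrix, so that `d_i c_ij = d_j c_ji`.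
(Mathlib's `cartanMatrix i j` is `⟨α_i, α_j^∨⟩`.) -/
def cartanEntry (b : P.Base) (i j : b.support) : ℤ :=
  b.cartanMatrix j i

/-- The root with index `θ` is the highest root: for every root `β`, the difference `θ - β` is
a sum of simple roots. -/
def IsHighestRoot (b : P.Base) (θ : ι) : Prop :=
  ∀ i : ι, P.root θ - P.root i ∈ AddSubmonoid.closure (P.root '' b.support)

open Classical in
/-- The dual Coxeter number `h^∨ = 1 + ⟨ρ, θ^∨⟩`, where `θ` is the highest root: `⟨ρ, θ^∨⟩` is the
sum of the coefficients of `θ^∨` in the basis of simple coroots. The highest root exists and is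
unique for irreducible root systems; the value `0` is used if there is none. -/
def dualCoxeterNumber (b : P.Base) : ℤ :=
  if h : ∃ θ : ι, IsHighestRoot b θ then 1 + b.flip.height h.choose else 0

/-- The integer `r h^∨`, the lacing number times the dual Coxeter number. -/
def rTimesDualCoxeter (b : P.Base) : ℤ :=
  lacingNumber P * dualCoxeterNumber b

/-- `w` is the longest element of the Weyl group: it sends every positive root to
a negative root. -/
def IsLongestElement (b : P.Base) (w : P.weylGroup) : Prop :=
  ∀ i : ι, b.IsPos i → ¬ b.IsPos (P.weylGroupToPerm w i)

/-- The longest element `w₀` of the Weyl group. -/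
def longestElement (b : P.Base) : P.weylGroup :=
  Classical.epsilon (IsLongestElement b)

/-- The involution `i ↦ i^*` on the set of simple roots, given by `w₀ α_i = - α_{i^*}`. -/
def starInvolution (b : P.Base) (i : b.support) : b.support :=
  haveI : Nonempty b.support := ⟨i⟩
  Classical.epsilon fun j : b.support => longestElement b • P.root i = - P.root j

/-- The quantum integer `[k]_z = (z^k - z^{-k}) / (z - z^{-1})`. -/
def qInt (k : ℤ) : RatFunc ℚ :=
  (RatFunc.X ^ k - RatFunc.X ^ (-k)) / (RatFunc.X - RatFunc.X⁻¹)

open Classical in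
/-- The quantum Cartan matrix `C(z)`, over the field of rational functions `ℚ(z)`. -/
def quantumCartan (b : P.Base) : Matrix b.support b.support (RatFunc ℚ) :=
  Matrix.of fun i j =>
    if i = j then RatFunc.X ^ symmetrizer P i + RatFunc.X ^ (-symmetrizer P i)
    else qInt (cartanEntry b i j)

open Classical in
/-- The inverse `C̃(z)` of the quantum Cartan matrix, over `ℚ(z)`. -/
def invQuantumCartan (b : P.Base) : Matrix b.support b.support (RatFunc ℚ) :=
  (quantumCartan b)⁻¹

/-- The coefficient `c̃_ij(u)` of `z^u` in the Laurent expansion at `z = 0` of the `(i, j)` entry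
of `C̃(z)`. -/
def invCoeff (b : P.Base) (i j : b.support) (u : ℤ) : ℚ :=
  HahnSeries.coeff (invQuantumCartan b i j : ℚ⸨X⸩) u

open Classical in
/-- The Kronecker delta. -/
def kroneckerDelta {I : Type*} (i j : I) : ℤ :=
  if i = j then 1 else 0

end

end QuantumCartan

open QuantumCartan

set_option linter.unusedSectionVars false

namespace QuantumCartan

noncomputable section

variable {ι K M N : Type*} [Fintype ι] [Field K] [CharZero K] [AddCommGroup M] [Module K M]
  [AddCommGroup N] [Module K N] {P : RootPairing ι K M N} [P.IsCrystallographic]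

/-! ### Lengths of roots -/

/-! Put `D = diag(z^{d_i})` and `A = C(z) D`, a polynomial matrix with `A(0) = 1` whose value at `z
= 1` is the Cartan matrix. The deformed reflections `T_i = 1 - E_ii A` specialize at `z = 1` to the
simple reflections. They are not involutions, but they satisfy the braid relations, by a rank-two
check in types A1×A1, A2, B2 and G2. Hence the product `T_w` along a reduced word depends only on
`w` (`IsLift.unique`).

The same rank-two computation shows that `w α_i > 0` forces the `i`-th column of `T_w` to have
nonnegative coefficients (`IsLift.nonnegCoeff`). Since `T_w T_i = T_w - T_w E_ii A`, summing along a
reduced word gives `T_w = 1 - Q A` with `Q` nonnegative.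

For `w = w₀` one has `T_{w₀} T_i = T_{i^*} T_{w₀}`. With the connectedness of the Dynkin diagram
this makes `T_{w₀}` a scalar multiple of the permutation matrix `σ` of the involution. As `det T_i =
-z^{2 d_i}`, the determinant and the value at `z = 1` identify the scalar as `-z^n`, where `n ·
rank` is the sum of the `d_β` over all roots. So `Q A = 1 + z^n σ` (`exists_mul_deformedCartan`).

That `n = r h^∨` (`sum_symmetrizerNat`) follows from the operator `x ↦ ∑ (β, x) β`. It is scalar by
irreducibility; its trace and its value at the highest root `θ` are compared using `∑ ⟨β, θ^∨⟩² = 4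
h^∨`.

Finally `C⁻¹ = D A⁻¹`, so the numerator `W = D Q` satisfies `W = C⁻¹ (1 + z^n σ)`. It has
nonnegative coefficients, and it is palindromic up to `σ` because `C(z) = C(z⁻¹)`. The symmetries,
zeros and signs are formal consequences (`IsQuasiPeriodic`). -/

lemma sqLength_pos (i : ι) : 0 < sqLength P i := (P.posRootForm ℤ).rootLength_pos i

lemma sqLength_cast (i : ι) :
    (sqLength P i : K) = (P.posRootForm ℤ).form (P.root i) (P.root i) :=
  (P.posRootForm ℤ).algebraMap_rootLength i

lemma sqLength_weylGroup (w : P.weylGroup) (i : ι) :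
    sqLength P (P.weylGroupToPerm w i) = sqLength P i := by
  apply Int.cast_injective (α := K)
  rw [sqLength_cast, sqLength_cast, ← P.weylGroup_apply_root]
  exact RootPairing.InvariantForm.apply_weylGroup_smul P
    (B := (P.posRootForm ℤ).toInvariantForm) w _ _

lemma pairingIn_mul_sqLength (i j : ι) :
    P.pairingIn ℤ j i * sqLength P i = P.pairingIn ℤ i j * sqLength P j :=
  (P.posRootForm ℤ).pairingIn_mul_eq_pairingIn_mul_swap i j

lemma symmetrizer_weylGroup (w : P.weylGroup) (i : ι) :
    symmetrizer P (P.weylGroupToPerm w i) = symmetrizer P i := by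
  rw [symmetrizer, sqLength_weylGroup, symmetrizer]

lemma exists_sqLength_eq_sInf [Nonempty ι] :
    ∃ i, sqLength P i = sInf (Set.range (sqLength P)) :=
  Int.csInf_mem (Set.range_nonempty _) ⟨0, by rintro _ ⟨i, rfl⟩; exact (sqLength_pos i).le⟩

lemma sInf_sqLength_le (i : ι) : sInf (Set.range (sqLength P)) ≤ sqLength P i :=
  csInf_le ⟨0, by rintro _ ⟨i, rfl⟩; exact (sqLength_pos i).le⟩ ⟨i, rfl⟩

lemma sInf_sqLength_pos [Nonempty ι] : 0 < sInf (Set.range (sqLength P)) := by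
  obtain ⟨i, hi⟩ := exists_sqLength_eq_sInf (P := P)
  exact hi ▸ sqLength_pos i

section Irreducible

variable [P.IsReduced] [P.IsIrreducible]

lemma sqLength_eq_or (i j : ι) :
    sqLength P i = sqLength P j ∨ sqLength P i = 2 * sqLength P j ∨
    sqLength P i = 3 * sqLength P j ∨ sqLength P j = 2 * sqLength P i ∨
    sqLength P j = 3 * sqLength P i := by
  have h := (P.posRootForm ℤ).toInvariantForm.apply_eq_or i j
  simp only [RootPairing.RootPositiveForm.toInvariantForm_form, ← sqLength_cast] at h
  exact_mod_cast h

lemma symmetrizer_spec (i : ι) :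
    sqLength P i = symmetrizer P i * sInf (Set.range (sqLength P)) ∧
      (symmetrizer P i = 1 ∨ symmetrizer P i = 2 ∨ symmetrizer P i = 3) := by
  have : Nonempty ι := ⟨i⟩
  obtain ⟨j, hj⟩ := exists_sqLength_eq_sInf (P := P)
  have h1 := sInf_sqLength_le (P := P) i
  have h0 := sInf_sqLength_pos (P := P)
  have h := sqLength_eq_or (P := P) i j
  unfold symmetrizer
  rw [hj] at h
  set m := sInf (Set.range (sqLength P))
  rcases h with h | h | h | h | h
  · rw [h, Int.ediv_self h0.ne']; simp
  · rw [h, Int.mul_ediv_cancel _ h0.ne']; simp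
  · rw [h, Int.mul_ediv_cancel _ h0.ne']; simp
  · lia
  · lia

lemma symmetrizer_pos (i : ι) : 0 < symmetrizer P i := by
  have := (symmetrizer_spec (P := P) i).2; lia

lemma pairingIn_mul_symmetrizer (i j : ι) :
    P.pairingIn ℤ j i * symmetrizer P i = P.pairingIn ℤ i j * symmetrizer P j := by
  have : Nonempty ι := ⟨i⟩
  have h0 := sInf_sqLength_pos (P := P)
  have := pairingIn_mul_sqLength (P := P) i j
  rw [(symmetrizer_spec i).1, (symmetrizer_spec j).1, ← mul_assoc, ← mul_assoc] at this
  exact mul_right_cancel₀ h0.ne' this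

end Irreducible

/-! ### Simple reflections and inversions -/

variable (b : P.Base)

lemma weylGroupToPerm_ofIdx (i k : ι) :
    P.weylGroupToPerm (RootPairing.weylGroup.ofIdx P i) k = P.reflectionPerm i k := rfl

lemma ofIdx_mul_self (i : ι) :
    RootPairing.weylGroup.ofIdx P i * RootPairing.weylGroup.ofIdx P i = 1 := by
  apply Subtype.ext
  apply RootPairing.Equiv.weightHom_injective P
  ext x
  simp [RootPairing.weylGroup.ofIdx]

lemma weylGroup_ext {v w : P.weylGroup} (h : ∀ x : M, v • x = w • x) : v = w := by
  apply Subtype.ext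
  apply RootPairing.Equiv.weightHom_injective P
  ext x
  exact h x

lemma weylGroup_ext_base [P.IsRootSystem] {v w : P.weylGroup}
    (h : ∀ i : b.support, v • P.root i = w • P.root i) : v = w := by
  apply Subtype.ext
  apply RootPairing.Equiv.weightHom_injective P
  apply LinearEquiv.toLinearMap_injective
  apply b.toWeightBasis.ext
  intro i
  simpa using! h i

/-- The linear extension of the height function. -/
def heightForm [P.IsRootSystem] : M →ₗ[K] K := b.toWeightBasis.constr K fun _ => 1

lemma heightForm_root [P.IsRootSystem] (k : ι) : heightForm b (P.root k) = b.height k := by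
  obtain ⟨f, -, -, hf⟩ := b.exists_root_eq_sum_int k
  rw [b.height_eq_sum hf, hf, map_sum]
  push_cast
  refine Finset.sum_congr rfl fun j hj => ?_
  have : P.root j = b.toWeightBasis ⟨j, hj⟩ := by simp
  rw [map_zsmul, this, heightForm, Module.Basis.constr_basis]
  simp

lemma root_reflectionPerm_self (i : ι) : P.root (P.reflectionPerm i i) = - P.root i := by
  simp

lemma isPos_of_root_eq_neg {i j : ι} (h : P.root j = - P.root i) : b.IsPos j ↔ ¬ b.IsPos i := by
  have hj : j = P.reflectionPerm i i := P.root.injective (by rw [h]; simp)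
  have := RootPairing.Base.IsPos.neg_iff_not b i
  rw [hj]
  exact this

lemma not_isPos_reflectionPerm_self {i : ι} (hi : i ∈ b.support) :
    ¬ b.IsPos (P.reflectionPerm i i) := by
  rw [isPos_of_root_eq_neg b (root_reflectionPerm_self i), not_not]
  exact RootPairing.Base.isPos_of_mem_support hi

/-- The positive roots made negative by `w`. -/
def inversions (w : P.weylGroup) : Finset ι := by
  classical exact Finset.univ.filter fun k => b.IsPos k ∧ ¬ b.IsPos (P.weylGroupToPerm w k)

lemma mem_inversions {w : P.weylGroup} {k : ι} :
    k ∈ inversions b w ↔ b.IsPos k ∧ ¬ b.IsPos (P.weylGroupToPerm w k) := by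
  classical
  rw [inversions, Finset.mem_filter]
  simp only [Finset.mem_univ, true_and]

lemma weylGroupToPerm_mul (v w : P.weylGroup) (k : ι) :
    P.weylGroupToPerm (v * w) k = P.weylGroupToPerm v (P.weylGroupToPerm w k) := by
  rw [map_mul]; rfl

lemma weylGroupToPerm_reflectionPerm_self (w : P.weylGroup) (i : ι) :
    b.IsPos (P.weylGroupToPerm w (P.reflectionPerm i i)) ↔ ¬ b.IsPos (P.weylGroupToPerm w i) := by
  apply isPos_of_root_eq_neg
  rw [← P.weylGroup_apply_root, ← P.weylGroup_apply_root, root_reflectionPerm_self, smul_neg]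

lemma isPos_mul_ofIdx_self (w : P.weylGroup) (i : ι) :
    b.IsPos (P.weylGroupToPerm (w * RootPairing.weylGroup.ofIdx P i) i) ↔
      ¬ b.IsPos (P.weylGroupToPerm w i) := by
  rw [weylGroupToPerm_mul, weylGroupToPerm_ofIdx, weylGroupToPerm_reflectionPerm_self]

/-- A simple reflection permutes the positive roots other than its own, so the inversions of `w s_i`
are `i` and the `s_i`-images of those of `w`. The weight `f` serves twice: `f = 1` counts
inversions, `f = d` computes determinants of lifts. -/
lemma sum_inversions_mul_ofIdx [P.IsReduced] {w : P.weylGroup} {i : ι} (hi : i ∈ b.support)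
    (hw : b.IsPos (P.weylGroupToPerm w i)) (f : ι → ℕ) (hf : ∀ k, f (P.reflectionPerm i k) = f k) :
    ∑ k ∈ inversions b (w * RootPairing.weylGroup.ofIdx P i), f k =
      (∑ k ∈ inversions b w, f k) + f i := by
  classical
  have hinv : ∀ k, P.reflectionPerm i (P.reflectionPerm i k) = k := fun k => by simp
  have hnot : i ∉ (inversions b w).image (P.reflectionPerm i) := by
    simp only [Finset.mem_image, mem_inversions, not_exists, not_and]
    rintro k ⟨hk, -⟩ hki
    have : k = P.reflectionPerm i i := by
      conv_rhs => rw [← hki]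
      rw [hki, ← hinv k, hki]
    exact not_isPos_reflectionPerm_self b hi (this ▸ hk)
  have h : inversions b (w * RootPairing.weylGroup.ofIdx P i) =
      insert i ((inversions b w).image (P.reflectionPerm i)) := by
    ext k
    rw [mem_inversions, weylGroupToPerm_mul, weylGroupToPerm_ofIdx, Finset.mem_insert,
      Finset.mem_image]
    constructor
    · rintro ⟨hk, hk'⟩
      rcases eq_or_ne k i with rfl | hne
      · exact Or.inl rfl
      · exact Or.inr ⟨P.reflectionPerm i k, (mem_inversions b).mpr
          ⟨hk.reflectionPerm hi hne, hk'⟩, hinv k⟩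
    · rintro (rfl | ⟨l, hl, rfl⟩)
      · exact ⟨RootPairing.Base.isPos_of_mem_support hi,
          by rwa [weylGroupToPerm_reflectionPerm_self, not_not]⟩
      · rw [mem_inversions] at hl
        rw [hinv]
        refine ⟨hl.1.reflectionPerm hi ?_, hl.2⟩
        rintro rfl
        exact hl.2 hw
  rw [h, Finset.sum_insert hnot, Finset.sum_image (fun x _ y _ h => (P.reflectionPerm i).injective h),
    add_comm]
  simp [hf]

/-- The number of positive roots made negative by `w`. -/
def inversionCount (w : P.weylGroup) : ℕ := (inversions b w).card

lemma inversionCount_mul_ofIdx [P.IsReduced] {w : P.weylGroup} {i : ι} (hi : i ∈ b.support)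
    (hw : b.IsPos (P.weylGroupToPerm w i)) :
    inversionCount b (w * RootPairing.weylGroup.ofIdx P i) = inversionCount b w + 1 := by
  have := sum_inversions_mul_ofIdx b hi hw (fun _ => 1) (fun _ => rfl)
  simpa [inversionCount] using this

lemma inversionCount_mul_ofIdx_of_neg [P.IsReduced] {w : P.weylGroup} {i : ι} (hi : i ∈ b.support)
    (hw : ¬ b.IsPos (P.weylGroupToPerm w i)) :
    inversionCount b (w * RootPairing.weylGroup.ofIdx P i) + 1 = inversionCount b w := by
  have := inversionCount_mul_ofIdx b (w := w * RootPairing.weylGroup.ofIdx P i) hi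
    ((isPos_mul_ofIdx_self b w i).mpr hw)
  rw [mul_assoc, ofIdx_mul_self, mul_one] at this
  exact this.symm

end

end QuantumCartan

namespace QuantumCartan

noncomputable section

/-! ### Polynomials with nonnegative coefficients -/

/-- All coefficients of the polynomial are nonnegative. -/
def NonnegCoeff (p : Polynomial ℤ) : Prop := ∀ n, 0 ≤ p.coeff n

lemma NonnegCoeff.zero : NonnegCoeff 0 := fun n => by simp

lemma NonnegCoeff.one : NonnegCoeff 1 := fun n => by
  rw [Polynomial.coeff_one]; split_ifs <;> simp

lemma NonnegCoeff.X_pow (k : ℕ) : NonnegCoeff (Polynomial.X ^ k) := fun n => by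
  rw [Polynomial.coeff_X_pow]; split_ifs <;> simp

lemma NonnegCoeff.X : NonnegCoeff Polynomial.X := by
  simpa using NonnegCoeff.X_pow 1

lemma NonnegCoeff.add {p q : Polynomial ℤ} (hp : NonnegCoeff p) (hq : NonnegCoeff q) :
    NonnegCoeff (p + q) := fun n => by
  rw [Polynomial.coeff_add]; exact add_nonneg (hp n) (hq n)

lemma NonnegCoeff.mul {p q : Polynomial ℤ} (hp : NonnegCoeff p) (hq : NonnegCoeff q) :
    NonnegCoeff (p * q) := fun n => by
  rw [Polynomial.coeff_mul]; exact Finset.sum_nonneg fun x _ => mul_nonneg (hp _) (hq _)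

lemma NonnegCoeff.eval_one {p : Polynomial ℤ} (hp : NonnegCoeff p) : 0 ≤ p.eval 1 := by
  rw [Polynomial.eval_eq_sum_range]
  exact Finset.sum_nonneg fun i _ => by simpa using hp i

/-! ### Alternating products -/

section Alternating

variable {S : Type*} [Monoid S]

/-- The alternating product `⋯ y x y x` with `n` factors. -/
def revAlt (x y : S) : ℕ → S
  | 0 => 1
  | n + 1 => revAlt y x n * x

/-- The alternating product `x y x y ⋯` with `n` factors. -/
def altProd (x y : S) : ℕ → S
  | 0 => 1
  | n + 1 => x * altProd y x n

lemma altProd_succ' (x y : S) (n : ℕ) :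
    altProd x y (n + 1) = altProd x y n * if Even n then x else y := by
  induction n generalizing x y with
  | zero => simp [altProd]
  | succ n ih =>
    rw [altProd, ih, ← mul_assoc]
    change altProd x y (n + 1) * _ = _
    simp only [Nat.even_add_one]
    split_ifs <;> rfl

/-- Both descriptions are needed: fixing the rightmost factor suits the action on a given simple
root, fixing the leftmost suits appending letters to a Weyl group element one by one. -/
lemma altProd_eq_revAlt (x y : S) (n : ℕ) :
    altProd x y n = if Even n then revAlt y x n else revAlt x y n := by
  induction n generalizing x y with
  | zero => simp [altProd, revAlt]
  | succ n ih =>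
    rw [altProd_succ', ih]
    simp only [Nat.even_add_one]
    split_ifs <;> simp_all [revAlt]

end Alternating

section Braid

variable {R S : Type*} [CommRing R] [Ring S] [Algebra R S]

lemma braid_two {a b : S} (hab : a * b = 0) (hba : b * a = 0) :
    revAlt (1 - a) (1 - b) 2 = revAlt (1 - b) (1 - a) 2 := by
  simp only [revAlt, one_mul, mul_sub, sub_mul, mul_one, hab, hba]
  abel

/-- The result is symmetric in `a` and `b` when `α - γ = 1` on both sides, which is the braid
relation of length three; the longer relations are obtained by multiplying this expansion further.
-/
lemma alternating_three {a b : S} {α γ : R} (ha : a * a = α • a) (haba : a * (b * a) = γ • a) :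
    revAlt (1 - a) (1 - b) 3 = 1 + (α - 2 - γ) • a - b + a * b + b * a := by
  simp only [revAlt, one_mul, mul_sub, sub_mul, mul_one, mul_assoc, ha, haba]
  module

lemma braid_three {a b : S} (y : R) (ha : a * a = (1 + y ^ 2) • a) (hb : b * b = (1 + y ^ 2) • b)
    (haba : a * (b * a) = y ^ 2 • a) (hbab : b * (a * b) = y ^ 2 • b) :
    revAlt (1 - a) (1 - b) 3 = revAlt (1 - b) (1 - a) 3 := by
  rw [alternating_three ha haba, alternating_three hb hbab]
  module

/-- The scalars are those of type B2: diagonal entries `1 + x^{2d}` with `d = 1, 2`, and the product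
`x (x + x³)` of the off-diagonal entries. -/
lemma braid_four {a b : S} (x : R) (ha : a * a = (1 + x ^ 2) • a) (hb : b * b = (1 + x ^ 4) • b)
    (haba : a * (b * a) = (x ^ 2 + x ^ 4) • a) (hbab : b * (a * b) = (x ^ 2 + x ^ 4) • b) :
    revAlt (1 - a) (1 - b) 4 = revAlt (1 - b) (1 - a) 4 := by
  rw [revAlt, alternating_three hb hbab, revAlt, alternating_three ha haba]
  simp only [mul_sub, sub_mul, add_mul, mul_one, one_mul, mul_assoc, ha, hb, haba, hbab,
    smul_mul_assoc, mul_smul_comm]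
  module

lemma braid_six {a b : S} (x : R) (ha : a * a = (1 + x ^ 2) • a) (hb : b * b = (1 + x ^ 6) • b)
    (haba : a * (b * a) = (x ^ 2 + x ^ 4 + x ^ 6) • a)
    (hbab : b * (a * b) = (x ^ 2 + x ^ 4 + x ^ 6) • b) :
    revAlt (1 - a) (1 - b) 6 = revAlt (1 - b) (1 - a) 6 := by
  have h6 : ∀ u v : S, revAlt u v 6 = revAlt v u 3 * revAlt u v 3 := fun u v => by
    simp only [revAlt, one_mul, mul_assoc]
  have e3 : a * (a * b) = (1 + x ^ 2) • (a * b) := by rw [← mul_assoc, ha, smul_mul_assoc]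
  have e4 : b * (b * a) = (1 + x ^ 6) • (b * a) := by rw [← mul_assoc, hb, smul_mul_assoc]
  rw [h6, h6, alternating_three hb hbab, alternating_three ha haba]
  simp only [mul_sub, sub_mul, add_mul, mul_add, mul_one, one_mul, mul_assoc, ha, hb, haba, hbab,
    smul_mul_assoc, mul_smul_comm, e3, e4]
  module

end Braid

/-! ### The deformed reflections -/

section Deformed

variable {I R : Type*} [Fintype I] [DecidableEq I] [CommRing R]

/-- The matrix of the deformed reflection `e_j ↦ e_j - A_ij e_i`. -/
def deformedReflection (A : Matrix I I R) (i : I) : Matrix I I R :=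
  1 - Matrix.single i i 1 * A

lemma single_mul_apply' (A : Matrix I I R) (i k l : I) :
    (Matrix.single i i (1 : R) * A) k l = if k = i then A i l else 0 := by
  split_ifs with h
  · subst h; simp
  · rw [Matrix.single_mul_apply_of_ne]; exact h

/-- `E_ii A` has a single nonzero row, so products of such matrices collapse to scalars; this
reduces the braid relations to identities in two noncommuting letters. -/
lemma single_mul_mul_single_mul (A : Matrix I I R) (i j : I) :
    (Matrix.single i i (1 : R) * A) * ((Matrix.single j j (1 : R) * A) *
      (Matrix.single i i (1 : R) * A)) = (A i j * A j i) • (Matrix.single i i (1 : R) * A) := by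
  ext k l
  simp only [Matrix.mul_apply (N := _ * _), single_mul_apply', Matrix.smul_apply]
  split_ifs with h
  · simp [mul_assoc]
  · simp

lemma single_mul_sq (A : Matrix I I R) (i : I) :
    (Matrix.single i i (1 : R) * A) * (Matrix.single i i (1 : R) * A) =
      A i i • (Matrix.single i i (1 : R) * A) := by
  ext k l
  simp only [Matrix.mul_apply (N := _ * _), single_mul_apply', Matrix.smul_apply]
  split_ifs with h
  · simp
  · simp

lemma single_mul_single_of_eq_zero (A : Matrix I I R) {i j : I} (h : A i j = 0) :
    (Matrix.single i i (1 : R) * A) * (Matrix.single j j (1 : R) * A) = 0 := by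
  ext k l
  simp only [Matrix.mul_apply (N := _ * _), single_mul_apply']
  split_ifs <;> simp [h]

lemma deformedReflection_mulVec (A : Matrix I I R) (i : I) (v : I → R) :
    (deformedReflection A i).mulVec v = v - (∑ l, A i l * v l) • Pi.single i 1 := by
  ext k
  rw [deformedReflection, Matrix.sub_mulVec, Matrix.one_mulVec, Pi.sub_apply, Pi.sub_apply,
    Matrix.mulVec, dotProduct]
  simp only [single_mul_apply', Pi.smul_apply, Pi.single_apply]
  split_ifs <;> simp

lemma deformedReflection_mulVec_pair (A : Matrix I I R) {i j : I} (hij : i ≠ j) (x y : R) :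
    (deformedReflection A i).mulVec (x • Pi.single i 1 + y • Pi.single j 1) =
      (x - A i i * x - A i j * y) • Pi.single i 1 + y • Pi.single j 1 := by
  rw [deformedReflection_mulVec]
  have : ∑ l, A i l * (x • Pi.single i 1 + y • Pi.single j 1 : I → R) l =
      A i i * x + A i j * y := by
    rw [Finset.sum_eq_add i j hij]
    · simp [hij, hij.symm]
    · rintro c - ⟨h1, h2⟩
      simp [h1, h2]
    · simp
    · simp
  rw [this]
  module

/-- A rank-one perturbation of the identity. For the deformed Cartan matrix the value is `-X^{2
d_i}`, so determinants of lifts record root lengths. -/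
lemma det_deformedReflection (A : Matrix I I R) (i : I) :
    (deformedReflection A i).det = 1 - A i i := by
  have : (Matrix.single i i (1 : R) * A) =
      Matrix.replicateCol Unit (Pi.single i (1 : R)) * Matrix.replicateRow Unit (A i) := by
    ext k l
    rw [single_mul_apply', Matrix.mul_apply]
    simp [Pi.single_apply]
  rw [deformedReflection, this, sub_eq_add_neg, ← Matrix.mul_neg, Matrix.det_one_add_mul_comm]
  simp [Matrix.mul_apply, sub_eq_add_neg, Pi.single_apply]

/-- The coordinate vectors `p e_i + q e_j` with `p`, `q` having nonnegative coefficients. -/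
def NonnegPair (i j : I) (v : I → Polynomial ℤ) : Prop :=
  ∃ p q, NonnegCoeff p ∧ NonnegCoeff q ∧ v = p • Pi.single i 1 + q • Pi.single j 1

/-- The length-`m` braid relation between the deformed reflections at `i` and `j`, together with
the positivity of all shorter alternating products. -/
def IsBraidPair (A : Matrix I I (Polynomial ℤ)) (i j : I) (m : ℕ) : Prop :=
  revAlt (deformedReflection A i) (deformedReflection A j) m =
    revAlt (deformedReflection A j) (deformedReflection A i) m ∧
  ∀ t < m,
    NonnegPair i j ((revAlt (deformedReflection A j) (deformedReflection A i) t).mulVec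
      (Pi.single i 1)) ∧
    NonnegPair i j ((revAlt (deformedReflection A i) (deformedReflection A j) t).mulVec
      (Pi.single j 1))

lemma NonnegPair.symm {i j : I} {v : I → Polynomial ℤ} (h : NonnegPair i j v) :
    NonnegPair j i v := by
  obtain ⟨p, q, hp, hq, rfl⟩ := h
  exact ⟨q, p, hq, hp, add_comm _ _⟩

lemma IsBraidPair.symm {A : Matrix I I (Polynomial ℤ)} {i j : I} {m : ℕ}
    (h : IsBraidPair A i j m) : IsBraidPair A j i m :=
  ⟨h.1.symm, fun t ht => ⟨(h.2 t ht).2.symm, (h.2 t ht).1.symm⟩⟩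

lemma NonnegPair.of_eq {i j : I} {x y : Polynomial ℤ} (p q : Polynomial ℤ) (hx : x = p) (hy : y = q)
    (hp : NonnegCoeff p) (hq : NonnegCoeff q) :
    NonnegPair i j (x • Pi.single i 1 + y • Pi.single j 1) :=
  ⟨p, q, hp, hq, by rw [hx, hy]⟩

lemma deformedReflection_mulVec_pair' (A : Matrix I I R) {i j : I} (hij : i ≠ j) (x y : R) :
    (deformedReflection A j).mulVec (x • Pi.single i 1 + y • Pi.single j 1) =
      x • Pi.single i 1 + (y - A j j * y - A j i * x) • Pi.single j 1 := by
  rw [add_comm, deformedReflection_mulVec_pair A hij.symm, add_comm]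

lemma single_eq_pair_left (i j : I) :
    (Pi.single i 1 : I → R) = (1 : R) • Pi.single i 1 + (0 : R) • Pi.single j 1 := by simp

lemma single_eq_pair_right (i j : I) :
    (Pi.single j 1 : I → R) = (0 : R) • Pi.single i 1 + (1 : R) • Pi.single j 1 := by simp

open Polynomial in
lemma isBraidPair_two (A : Matrix I I (Polynomial ℤ)) {i j : I} (hij : i ≠ j) (h1 : A i j = 0)
    (h2 : A j i = 0) : IsBraidPair A i j 2 := by
  refine ⟨braid_two (single_mul_single_of_eq_zero A h1) (single_mul_single_of_eq_zero A h2), ?_⟩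
  intro t ht
  constructor
  · rw [single_eq_pair_left i j]
    interval_cases t <;> simp only [revAlt, one_mul, Matrix.one_mulVec,
      deformedReflection_mulVec_pair' A hij, h2]
    · exact .of_eq 1 0 rfl rfl .one .zero
    · exact .of_eq 1 0 rfl (by ring) .one .zero
  · rw [single_eq_pair_right i j]
    interval_cases t <;> simp only [revAlt, one_mul, Matrix.one_mulVec,
      deformedReflection_mulVec_pair A hij, h1]
    · exact .of_eq 0 1 rfl rfl .zero .one
    · exact .of_eq 0 1 (by ring) rfl .zero .one

open Polynomial in
lemma isBraidPair_three (A : Matrix I I (Polynomial ℤ)) {i j : I} (hij : i ≠ j) (d : ℕ)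
    (hi : A i i = 1 + X ^ (2 * d)) (hj : A j j = 1 + X ^ (2 * d))
    (h1 : A i j = - X ^ d) (h2 : A j i = - X ^ d) : IsBraidPair A i j 3 := by
  have hd : (X ^ (2 * d) : Polynomial ℤ) = (X ^ d) ^ 2 := by ring
  rw [hd] at hi hj
  refine ⟨braid_three (R := ℤ[X]) (X ^ d) ?_ ?_ ?_ ?_, ?_⟩
  · rw [single_mul_sq, hi]
  · rw [single_mul_sq, hj]
  · rw [single_mul_mul_single_mul, h1, h2]; ring_nf
  · rw [single_mul_mul_single_mul, h1, h2]; ring_nf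
  intro t ht
  constructor
  · rw [single_eq_pair_left i j]
    interval_cases t <;> simp only [revAlt, one_mul, Matrix.one_mulVec, ← Matrix.mulVec_mulVec,
      deformedReflection_mulVec_pair' A hij, deformedReflection_mulVec_pair A hij, h1, h2, hi, hj]
    · exact .of_eq 1 0 (by ring) (by ring) .one .zero
    · exact .of_eq 1 (X ^ d) (by ring) (by ring) .one (.X_pow d)
    · exact .of_eq 0 (X ^ d) (by ring) (by ring) .zero (.X_pow d)
  · rw [single_eq_pair_right i j]
    interval_cases t <;> simp only [revAlt, one_mul, Matrix.one_mulVec, ← Matrix.mulVec_mulVec,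
      deformedReflection_mulVec_pair' A hij, deformedReflection_mulVec_pair A hij, h1, h2, hi, hj]
    · exact .of_eq 0 1 (by ring) (by ring) .zero .one
    · exact .of_eq (X ^ d) 1 (by ring) (by ring) (.X_pow d) .one
    · exact .of_eq (X ^ d) 0 (by ring) (by ring) (.X_pow d) .zero

open Polynomial in
-- Type B2, with `i` short and `j` long. The listed pairs are the coordinates of the successive
-- images of a basis vector; at `X = 1` they become the positive roots of the same length as the
-- starting root.
lemma isBraidPair_four (A : Matrix I I (Polynomial ℤ)) {i j : I} (hij : i ≠ j)
    (hi : A i i = 1 + X ^ 2) (hj : A j j = 1 + X ^ 4)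
    (h1 : A i j = - (X + X ^ 3)) (h2 : A j i = - X) : IsBraidPair A i j 4 := by
  refine ⟨braid_four (R := ℤ[X]) X ?_ ?_ ?_ ?_, ?_⟩
  · rw [single_mul_sq, hi]
  · rw [single_mul_sq, hj]
  · rw [single_mul_mul_single_mul, h1, h2]; ring_nf
  · rw [single_mul_mul_single_mul, h1, h2]; ring_nf
  intro t ht
  constructor
  · rw [single_eq_pair_left i j]
    interval_cases t <;> simp only [revAlt, one_mul, Matrix.one_mulVec, ← Matrix.mulVec_mulVec,
      deformedReflection_mulVec_pair' A hij, deformedReflection_mulVec_pair A hij, h1, h2, hi, hj]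
    · exact .of_eq 1 0 (by ring) (by ring) .one .zero
    · exact .of_eq 1 X (by ring) (by ring) .one .X
    · exact .of_eq (X ^ 4) X (by ring) (by ring) (.X_pow 4) .X
    · exact .of_eq (X ^ 4) 0 (by ring) (by ring) (.X_pow 4) .zero
  · have h13 := NonnegCoeff.X.add (.X_pow 3)
    rw [single_eq_pair_right i j]
    interval_cases t <;> simp only [revAlt, one_mul, Matrix.one_mulVec, ← Matrix.mulVec_mulVec,
      deformedReflection_mulVec_pair' A hij, deformedReflection_mulVec_pair A hij, h1, h2, hi, hj]
    · exact .of_eq 0 1 (by ring) (by ring) .zero .one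
    · exact .of_eq (X + X ^ 3) 1 (by ring) (by ring) h13 .one
    · exact .of_eq (X + X ^ 3) (X ^ 2) (by ring) (by ring) h13 (.X_pow 2)
    · exact .of_eq 0 (X ^ 2) (by ring) (by ring) .zero (.X_pow 2)

open Polynomial in
lemma isBraidPair_six (A : Matrix I I (Polynomial ℤ)) {i j : I} (hij : i ≠ j)
    (hi : A i i = 1 + X ^ 2) (hj : A j j = 1 + X ^ 6)
    (h1 : A i j = - (X + X ^ 3 + X ^ 5)) (h2 : A j i = - X) : IsBraidPair A i j 6 := by
  refine ⟨braid_six (R := ℤ[X]) X ?_ ?_ ?_ ?_, ?_⟩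
  · rw [single_mul_sq, hi]
  · rw [single_mul_sq, hj]
  · rw [single_mul_mul_single_mul, h1, h2]; ring_nf
  · rw [single_mul_mul_single_mul, h1, h2]; ring_nf
  intro t ht
  constructor
  · have h46 := (NonnegCoeff.X_pow 4).add (.X_pow 6)
    rw [single_eq_pair_left i j]
    interval_cases t <;> simp only [revAlt, one_mul, Matrix.one_mulVec, ← Matrix.mulVec_mulVec,
      deformedReflection_mulVec_pair' A hij, deformedReflection_mulVec_pair A hij, h1, h2, hi, hj]
    · exact .of_eq 1 0 (by ring) (by ring) .one .zero
    · exact .of_eq 1 X (by ring) (by ring) .one .X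
    · exact .of_eq (X ^ 4 + X ^ 6) X (by ring) (by ring) h46 .X
    · exact .of_eq (X ^ 4 + X ^ 6) (X ^ 5) (by ring) (by ring) h46 (.X_pow 5)
    · exact .of_eq (X ^ 10) (X ^ 5) (by ring) (by ring) (.X_pow 10) (.X_pow 5)
    · exact .of_eq (X ^ 10) 0 (by ring) (by ring) (.X_pow 10) .zero
  · have h135 := (NonnegCoeff.X.add (.X_pow 3)).add (.X_pow 5)
    have h579 := ((NonnegCoeff.X_pow 5).add (.X_pow 7)).add (.X_pow 9)
    have h24 := (NonnegCoeff.X_pow 2).add (.X_pow 4)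
    rw [single_eq_pair_right i j]
    interval_cases t <;> simp only [revAlt, one_mul, Matrix.one_mulVec, ← Matrix.mulVec_mulVec,
      deformedReflection_mulVec_pair' A hij, deformedReflection_mulVec_pair A hij, h1, h2, hi, hj]
    · exact .of_eq 0 1 (by ring) (by ring) .zero .one
    · exact .of_eq (X + X ^ 3 + X ^ 5) 1 (by ring) (by ring) h135 .one
    · exact .of_eq (X + X ^ 3 + X ^ 5) (X ^ 2 + X ^ 4) (by ring) (by ring) h135 h24
    · exact .of_eq (X ^ 5 + X ^ 7 + X ^ 9) (X ^ 2 + X ^ 4) (by ring) (by ring) h579 h24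
    · exact .of_eq (X ^ 5 + X ^ 7 + X ^ 9) (X ^ 6) (by ring) (by ring) h579 (.X_pow 6)
    · exact .of_eq 0 (X ^ 6) (by ring) (by ring) .zero (.X_pow 6)

end Deformed

end

end QuantumCartan

namespace QuantumCartan

noncomputable section

open scoped Classical

variable {ι K M N : Type*} [Fintype ι] [Field K] [CharZero K] [AddCommGroup M] [Module K M]
  [AddCommGroup N] [Module K N] {P : RootPairing ι K M N} [P.IsCrystallographic]

/-! ### The deformed Cartan matrix over `ℤ[X]` -/

/-- The symmetrizer as a natural number. -/
def symmetrizerNat (P : RootPairing ι K M N) [P.IsCrystallographic] (i : ι) : ℕ :=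
  (symmetrizer P i).toNat

/-- The number `-c_ij` as a natural number. -/
def cartanNat (b : P.Base) (i j : b.support) : ℕ := (-cartanEntry b i j).toNat

open Polynomial in
/-- The matrix `C(z) diag(z^{d_j})`, which has polynomial entries. -/
def deformedCartan (b : P.Base) : Matrix b.support b.support (Polynomial ℤ) :=
  Matrix.of fun i j => if i = j then 1 + X ^ (2 * symmetrizerNat P i) else
    - ∑ k ∈ Finset.range (cartanNat b i j), X ^ (symmetrizerNat P j + 1 + 2 * k - cartanNat b i j)

open Polynomial in
lemma deformedCartan_self (b : P.Base) (i : b.support) :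
    deformedCartan b i i = 1 + X ^ (2 * symmetrizerNat P i) := by simp [deformedCartan]

open Polynomial in
lemma deformedCartan_of_ne (b : P.Base) {i j : b.support} (h : i ≠ j) :
    deformedCartan b i j = - ∑ k ∈ Finset.range (cartanNat b i j),
      X ^ (symmetrizerNat P j + 1 + 2 * k - cartanNat b i j) := by simp [deformedCartan, h]

variable (b : P.Base)

lemma cartanEntry_self (i : b.support) : cartanEntry b i i = 2 := b.cartanMatrix_apply_same i

lemma cartanEntry_of_ne {i j : b.support} (h : i ≠ j) :
    cartanEntry b i j = - cartanNat b i j := by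
  have := b.cartanMatrix_le_zero_of_ne j i h.symm
  rw [cartanNat, Int.toNat_of_nonneg (by simpa [cartanEntry] using this)]
  ring

lemma deformedCartan_eval_one (i j : b.support) :
    (deformedCartan b i j).eval 1 = cartanEntry b i j := by
  rcases eq_or_ne i j with rfl | h
  · rw [deformedCartan_self, cartanEntry_self]; simp
  · rw [deformedCartan_of_ne b h, cartanEntry_of_ne b h]
    simp [Polynomial.eval_finsetSum]

section Irreducible

variable [P.IsReduced] [P.IsIrreducible]

lemma symmetrizerNat_cast (i : ι) : (symmetrizerNat P i : ℤ) = symmetrizer P i :=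
  Int.toNat_of_nonneg (symmetrizer_pos i).le

lemma symmetrizerNat_pos (i : ι) : 0 < symmetrizerNat P i := by
  have := symmetrizer_pos (P := P) i
  have := symmetrizerNat_cast (P := P) i
  lia

lemma symmetrizerNat_weylGroup (w : P.weylGroup) (i : ι) :
    symmetrizerNat P (P.weylGroupToPerm w i) = symmetrizerNat P i := by
  rw [symmetrizerNat, symmetrizer_weylGroup, symmetrizerNat]

/-- The crystallographic condition leaves finitely many pairs of Cartan integers. Symmetrizability
with `d ∈ {1, 2, 3}` then forces the values of `d` on a multiple bond, while on a simple bond only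
their equality is known. -/
lemma rank_two_cases {i j : b.support} (h : i ≠ j) :
    (cartanNat b i j = 0 ∧ cartanNat b j i = 0) ∨
    (cartanNat b i j = 1 ∧ cartanNat b j i = 1 ∧ symmetrizerNat P i = symmetrizerNat P j) ∨
    (cartanNat b i j = 2 ∧ cartanNat b j i = 1 ∧ symmetrizerNat P i = 1 ∧
      symmetrizerNat P j = 2) ∨
    (cartanNat b i j = 1 ∧ cartanNat b j i = 2 ∧ symmetrizerNat P i = 2 ∧
      symmetrizerNat P j = 1) ∨
    (cartanNat b i j = 3 ∧ cartanNat b j i = 1 ∧ symmetrizerNat P i = 1 ∧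
      symmetrizerNat P j = 3) ∨
    (cartanNat b i j = 1 ∧ cartanNat b j i = 3 ∧ symmetrizerNat P i = 3 ∧
      symmetrizerNat P j = 1) := by
  have hne : (i : ι) ≠ j := fun e => h (Subtype.ext e)
  have h1 := P.pairingIn_pairingIn_mem_set_of_isCrystal_of_isRed' (i := i) (j := j)
    (fun e => hne (P.root.injective e)) (b.root_ne_neg_of_ne i.2 j.2 hne)
  have h2 : P.pairingIn ℤ j i = - cartanNat b i j := cartanEntry_of_ne b h
  have h3 : P.pairingIn ℤ i j = - cartanNat b j i := cartanEntry_of_ne b h.symm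
  have h4 := pairingIn_mul_symmetrizer (P := P) i j
  have h5 := (symmetrizer_spec (P := P) i).2
  have h6 := (symmetrizer_spec (P := P) j).2
  rw [← symmetrizerNat_cast] at h5 h6
  rw [← symmetrizerNat_cast, ← symmetrizerNat_cast, h2, h3] at h4
  rw [h2, h3] at h1
  simp only [Set.mem_insert_iff, Set.mem_singleton_iff, Prod.mk.injEq] at h1
  generalize cartanNat b i j = x at *
  generalize cartanNat b j i = y at *
  generalize symmetrizerNat P i = u at *
  generalize symmetrizerNat P j = v at *
  rcases h1 with h1 | h1 | h1 | h1 | h1 | h1 | h1 | h1 | h1 | h1 | h1 <;>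
    first
    | (exfalso; lia)
    | (rw [h1.1, h1.2] at h4; lia)

open Polynomial in
lemma exists_isBraidPair {i j : b.support} (h : i ≠ j) :
    ∃ m, IsBraidPair (deformedCartan b) i j (m + 1) := by
  have h1 := deformedCartan_of_ne b h
  have h2 := deformedCartan_of_ne b h.symm
  have hi := deformedCartan_self b i
  have hj := deformedCartan_self b j
  rcases rank_two_cases b h with ⟨e1, e2⟩ | ⟨e1, e2, e3⟩ | ⟨e1, e2, e3, e4⟩ | ⟨e1, e2, e3, e4⟩ |
    ⟨e1, e2, e3, e4⟩ | ⟨e1, e2, e3, e4⟩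
  · refine ⟨1, isBraidPair_two _ h ?_ ?_⟩
    · rw [h1, e1]; simp
    · rw [h2, e2]; simp
  · refine ⟨2, isBraidPair_three _ h (symmetrizerNat P j) ?_ ?_ ?_ ?_⟩
    · rw [hi, e3]
    · rw [hj]
    · rw [h1, e1]; simp
    · rw [h2, e2, e3]; simp
  · refine ⟨3, isBraidPair_four _ h ?_ ?_ ?_ ?_⟩
    · rw [hi, e3]
    · rw [hj, e4]
    · rw [h1, e1, e4]; simp [Finset.sum_range_succ]
    · rw [h2, e2, e3]; simp
  · refine ⟨3, (isBraidPair_four _ h.symm ?_ ?_ ?_ ?_).symm⟩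
    · rw [hj, e4]
    · rw [hi, e3]
    · rw [h2, e2, e3]; simp [Finset.sum_range_succ]
    · rw [h1, e1, e4]; simp
  · refine ⟨5, isBraidPair_six _ h ?_ ?_ ?_ ?_⟩
    · rw [hi, e3]
    · rw [hj, e4]
    · rw [h1, e1, e4]; simp [Finset.sum_range_succ]
    · rw [h2, e2, e3]; simp
  · refine ⟨5, (isBraidPair_six _ h.symm ?_ ?_ ?_ ?_).symm⟩
    · rw [hj, e4]
    · rw [hi, e3]
    · rw [h2, e2, e3]; simp [Finset.sum_range_succ]
    · rw [h1, e1, e4]; simp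

end Irreducible

/-! ### Specialization at `X = 1` -/

/-- The simple reflection at `i` as an element of the Weyl group. -/
abbrev simpleRefl (i : b.support) : P.weylGroup := RootPairing.weylGroup.ofIdx P i

/-- The deformation of the simple reflection at `i`. -/
abbrev liftRefl (i : b.support) : Matrix b.support b.support (Polynomial ℤ) :=
  deformedReflection (deformedCartan b) i

/-- The specialization of a coordinate vector at `X = 1`. -/
def specialize (v : b.support → Polynomial ℤ) : M := ∑ k, ((v k).eval 1 : ℤ) • P.root k

lemma specialize_add (u v : b.support → Polynomial ℤ) :
    specialize b (u + v) = specialize b u + specialize b v := by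
  simp [specialize, add_smul, Finset.sum_add_distrib]

lemma specialize_smul (p : Polynomial ℤ) (v : b.support → Polynomial ℤ) :
    specialize b (p • v) = (p.eval 1 : ℤ) • specialize b v := by
  simp [specialize, Finset.smul_sum, mul_smul]

lemma specialize_single (i : b.support) : specialize b (Pi.single i 1) = P.root i := by
  rw [specialize, Finset.sum_eq_single i]
  · simp
  · intro k _ hk; simp [hk]
  · simp

lemma simpleRefl_smul_root (i k : b.support) :
    simpleRefl b i • P.root k = P.root k - cartanEntry b i k • P.root i := by
  change P.reflection i (P.root k) = _
  rw [RootPairing.reflection_apply_root' ℤ]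
  rfl

lemma smul_zsmul_comm' (w : P.weylGroup) (n : ℤ) (x : M) : w • (n • x) = n • (w • x) :=
  map_zsmul (DistribSMul.toAddMonoidHom M w) n x

/-- At `X = 1` the deformed Cartan matrix becomes the Cartan matrix, so identities and positivity
between lifts descend to the Weyl group. -/
lemma specialize_liftRefl (i : b.support) (v : b.support → Polynomial ℤ) :
    specialize b ((liftRefl b i).mulVec v) = simpleRefl b i • specialize b v := by
  have h : (liftRefl b i).mulVec v =
      v + (-∑ l, deformedCartan b i l * v l) • Pi.single i 1 := by
    rw [liftRefl, deformedReflection_mulVec, neg_smul, sub_eq_add_neg]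
  rw [h, specialize_add, specialize_smul, specialize_single, specialize, Finset.smul_sum]
  simp only [smul_zsmul_comm', simpleRefl_smul_root, smul_sub, Finset.sum_sub_distrib,
    Polynomial.eval_neg, Polynomial.eval_finsetSum, Polynomial.eval_mul, deformedCartan_eval_one,
    neg_smul, Finset.sum_smul, smul_smul, mul_comm]
  rw [← sub_eq_add_neg]

lemma specialize_revAlt (i j : b.support) (n : ℕ) (v : b.support → Polynomial ℤ) :
    specialize b ((revAlt (liftRefl b i) (liftRefl b j) n).mulVec v) =
      revAlt (simpleRefl b i) (simpleRefl b j) n • specialize b v := by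
  induction n generalizing i j v with
  | zero => simp [revAlt]
  | succ n ih =>
    rw [revAlt, revAlt, ← Matrix.mulVec_mulVec, ih, specialize_liftRefl, mul_smul]

/-- The braid relation in the Weyl group is read off from its deformation at `X = 1`, so no separate
computation of orders is required. -/
lemma revAlt_simpleRefl_comm [P.IsRootSystem] {i j : b.support} {m : ℕ}
    (h : IsBraidPair (deformedCartan b) i j m) :
    revAlt (simpleRefl b i) (simpleRefl b j) m = revAlt (simpleRefl b j) (simpleRefl b i) m := by
  apply weylGroup_ext_base b
  intro k
  rw [← specialize_single, ← specialize_revAlt, ← specialize_revAlt]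
  exact congrArg (fun X => specialize b (Matrix.mulVec X (Pi.single k 1))) h.1

/-! ### Lifting Weyl group elements to products of deformed reflections -/

/-- `IsLift b w X` says that `X` is the product of the deformed reflections along a reduced word
of `w`. -/
inductive IsLift : P.weylGroup → Matrix b.support b.support (Polynomial ℤ) → Prop
  | one : IsLift 1 1
  | step {w : P.weylGroup} {X : Matrix b.support b.support (Polynomial ℤ)} (i : b.support) :
      IsLift w X → b.IsPos (P.weylGroupToPerm w i) → IsLift (w * simpleRefl b i) (X * liftRefl b i)

lemma IsLift.specialize {w : P.weylGroup} {X : Matrix b.support b.support (Polynomial ℤ)}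
    (h : IsLift b w X) (v : b.support → Polynomial ℤ) :
    specialize b (X.mulVec v) = w • specialize b v := by
  induction h generalizing v with
  | one => simp
  | step i _ _ ih => rw [← Matrix.mulVec_mulVec, ih, specialize_liftRefl, mul_smul]

/-- `w` is a product of `n` simple reflections. -/
def IsWord (n : ℕ) (w : P.weylGroup) : Prop :=
  ∃ l : List b.support, l.length = n ∧ w = (l.map (simpleRefl b)).prod

lemma IsWord.mul_simpleRefl {n : ℕ} {w : P.weylGroup} (h : IsWord b n w) (i : b.support) :
    IsWord b (n + 1) (w * simpleRefl b i) := by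
  obtain ⟨l, rfl, rfl⟩ := h
  exact ⟨l ++ [i], by simp, by simp⟩

lemma isWord_succ_iff {n : ℕ} {w : P.weylGroup} :
    IsWord b (n + 1) w ↔ ∃ u i, IsWord b n u ∧ w = u * simpleRefl b i := by
  constructor
  · rintro ⟨l, hl, rfl⟩
    have hne : l ≠ [] := by rintro rfl; simp at hl
    refine ⟨(l.dropLast.map (simpleRefl b)).prod, l.getLast hne, ⟨_, by simp [hl], rfl⟩, ?_⟩
    conv_lhs => rw [← List.dropLast_append_getLast hne]
    simp
  · rintro ⟨u, i, hu, rfl⟩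
    exact hu.mul_simpleRefl b i

lemma ofIdx_reflectionPerm (i j : ι) :
    RootPairing.weylGroup.ofIdx P (P.reflectionPerm j i) =
      RootPairing.weylGroup.ofIdx P j * RootPairing.weylGroup.ofIdx P i *
        RootPairing.weylGroup.ofIdx P j := by
  apply weylGroup_ext
  intro x
  rw [mul_smul, mul_smul]
  change P.reflection _ x = P.reflection _ (P.reflection _ (P.reflection _ x))
  rw [RootPairing.reflection_reflectionPerm]
  rfl

lemma exists_isWord [P.IsReduced] (w : P.weylGroup) : ∃ n, IsWord b n w := by
  suffices h : ∃ l : List b.support, w = (l.map (simpleRefl b)).prod by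
    obtain ⟨l, hl⟩ := h
    exact ⟨_, l, rfl, hl⟩
  have hmul : ∀ v w : P.weylGroup, (∃ l : List b.support, v = (l.map (simpleRefl b)).prod) →
      (∃ l : List b.support, w = (l.map (simpleRefl b)).prod) →
      ∃ l : List b.support, v * w = (l.map (simpleRefl b)).prod := by
    rintro _ _ ⟨l, rfl⟩ ⟨l', rfl⟩
    exact ⟨l ++ l', by simp⟩
  obtain ⟨w, hw⟩ := w
  induction hw using RootPairing.weylGroup.induction with
  | one => exact ⟨[], rfl⟩
  | mul x y hx hy h1 h2 => exact hmul _ _ h1 h2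
  | mem i =>
    change ∃ l : List b.support, RootPairing.weylGroup.ofIdx P i = (l.map (simpleRefl b)).prod
    induction i using b.induction_reflect with
    | h₀ i hi =>
      rw [ofIdx_reflectionPerm]
      exact hmul _ _ (hmul _ _ hi hi) hi
    | h₁ i hi => exact ⟨[⟨i, hi⟩], by simp⟩
    | h₂ i j hi hj =>
      have h : ∃ l : List b.support, RootPairing.weylGroup.ofIdx P j =
        (l.map (simpleRefl b)).prod := ⟨[⟨j, hj⟩], by simp⟩
      rw [ofIdx_reflectionPerm]
      exact hmul _ _ (hmul _ _ h hi) h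

/-- The exchange condition. Follow the root `k` through the word from the right: it first turns
negative when it meets the simple root of a letter, and reflecting in `k` deletes that letter. -/
lemma IsWord.exchange [P.IsReduced] {n : ℕ} {w : P.weylGroup} (h : IsWord b n w) {k : ι}
    (hk : b.IsPos k) (hw : ¬ b.IsPos (P.weylGroupToPerm w k)) :
    ∃ m, n = m + 1 ∧ IsWord b m (w * RootPairing.weylGroup.ofIdx P k) := by
  induction n generalizing w k with
  | zero =>
    obtain ⟨l, hl, rfl⟩ := h
    rw [List.length_eq_zero_iff.mp hl] at hw
    exact absurd hk (by simpa using hw)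
  | succ n ih =>
    obtain ⟨u, i, hu, rfl⟩ := (isWord_succ_iff b).mp h
    refine ⟨n, rfl, ?_⟩
    rcases eq_or_ne k i with rfl | hki
    · rwa [mul_assoc, ofIdx_mul_self, mul_one]
    · have hk' := hk.reflectionPerm i.2 hki
      obtain ⟨m, rfl, hm⟩ := ih hu hk' (by rwa [weylGroupToPerm_mul] at hw)
      have := hm.mul_simpleRefl b i
      rw [ofIdx_reflectionPerm] at this
      have e := ofIdx_mul_self (P := P) i
      rwa [mul_assoc, mul_assoc, e, mul_one, ← mul_assoc] at this

/-- A word of minimal length is reduced: were its last letter to send a negative root to a positive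
one, exchange would give a word with two letters fewer. -/
lemma IsWord.exists_isLift [P.IsReduced] {n : ℕ} {w : P.weylGroup} (h : IsWord b n w)
    (hmin : ∀ m < n, ¬ IsWord b m w) : ∃ X, IsLift b w X := by
  induction n generalizing w with
  | zero =>
    obtain ⟨l, hl, rfl⟩ := h
    rw [List.length_eq_zero_iff.mp hl]
    exact ⟨1, .one⟩
  | succ n ih =>
    obtain ⟨u, i, hu, rfl⟩ := (isWord_succ_iff b).mp h
    obtain ⟨X, hX⟩ := ih hu fun m hm hm' => hmin (m + 1) (by lia) (hm'.mul_simpleRefl b i)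
    refine ⟨_, hX.step i ?_⟩
    by_contra hneg
    obtain ⟨m, rfl, hm⟩ := hu.exchange b (RootPairing.Base.isPos_of_mem_support i.2) hneg
    exact hmin m (by lia) hm

lemma exists_isLift [P.IsReduced] (w : P.weylGroup) : ∃ X, IsLift b w X := by
  have h := exists_isWord b w
  exact (Nat.find_spec h).exists_isLift b fun m hm => Nat.find_min h hm

end

end QuantumCartan

namespace QuantumCartan

noncomputable section

open scoped Classical

variable {ι K M N : Type*} [Fintype ι] [Field K] [CharZero K] [AddCommGroup M] [Module K M]
  [AddCommGroup N] [Module K N] {P : RootPairing ι K M N} [P.IsCrystallographic]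
  (b : P.Base)

/-! ### Independence of the reduced word -/

lemma IsLift.eq_or {w : P.weylGroup} {X : Matrix b.support b.support (Polynomial ℤ)}
    (h : IsLift b w X) : (w = 1 ∧ X = 1) ∨ ∃ (u : P.weylGroup) (Y : Matrix b.support b.support (Polynomial ℤ))
      (i : b.support), IsLift b u Y ∧
      b.IsPos (P.weylGroupToPerm u i) ∧ w = u * simpleRefl b i ∧ X = Y * liftRefl b i := by
  cases h with
  | one => exact Or.inl ⟨rfl, rfl⟩
  | step i h hi => exact Or.inr ⟨_, _, i, h, hi, rfl, rfl⟩

lemma mul_simpleRefl_cancel (w : P.weylGroup) (i : b.support) :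
    w * simpleRefl b i * simpleRefl b i = w := by
  rw [mul_assoc, ofIdx_mul_self, mul_one]

lemma not_isPos_of_root_eq [P.IsRootSystem] {w : P.weylGroup} {i j k : ι} {p q : ℤ} (hp : 0 ≤ p)
    (hq : 0 ≤ q) (hk : P.root k = p • P.root i + q • P.root j)
    (hi : ¬ b.IsPos (P.weylGroupToPerm w i)) (hj : ¬ b.IsPos (P.weylGroupToPerm w j)) :
    ¬ b.IsPos (P.weylGroupToPerm w k) := by
  have h : b.height (P.weylGroupToPerm w k) =
      p * b.height (P.weylGroupToPerm w i) + q * b.height (P.weylGroupToPerm w j) := by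
    apply Int.cast_injective (α := K)
    push_cast
    simp only [← heightForm_root, ← P.weylGroup_apply_root]
    rw [hk, smul_add, smul_zsmul_comm', smul_zsmul_comm', map_add, map_zsmul, map_zsmul]
    simp
  rw [RootPairing.Base.isPos_iff, not_lt] at hi hj ⊢
  rw [h]
  nlinarith [mul_nonneg hp (neg_nonneg.mpr hi), mul_nonneg hq (neg_nonneg.mpr hj)]

lemma NonnegPair.not_isPos [P.IsRootSystem] {v w : P.weylGroup} {i j l : b.support}
    {u : b.support → Polynomial ℤ} (hu : NonnegPair i j u) (hl : specialize b u = v • P.root l)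
    (hi : ¬ b.IsPos (P.weylGroupToPerm w i)) (hj : ¬ b.IsPos (P.weylGroupToPerm w j)) :
    ¬ b.IsPos (P.weylGroupToPerm (w * v) l) := by
  obtain ⟨p, q, hp, hq, rfl⟩ := hu
  rw [weylGroupToPerm_mul]
  refine not_isPos_of_root_eq b hp.eval_one hq.eval_one ?_ hi hj
  rw [← P.weylGroup_apply_root, ← hl, specialize_add, specialize_smul, specialize_smul,
    specialize_single, specialize_single]

/-- The alternating images of `α_i` and `α_j` are nonnegative combinations of these two roots. If
`w` makes both negative, then each of the first `m` alternating letters appended to `w` removes an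
inversion. -/
lemma IsBraidPair.not_isPos_altProd [P.IsRootSystem] {i j : b.support} {m : ℕ}
    (h : IsBraidPair (deformedCartan b) i j m) {w : P.weylGroup}
    (hi : ¬ b.IsPos (P.weylGroupToPerm w i)) (hj : ¬ b.IsPos (P.weylGroupToPerm w j))
    {t : ℕ} (ht : t < m) :
    ¬ b.IsPos (P.weylGroupToPerm (w * altProd (simpleRefl b i) (simpleRefl b j) t)
      (if Even t then i else j : b.support)) := by
  rw [altProd_eq_revAlt]
  split_ifs with he
  · exact (h.2 t ht).1.not_isPos b (by rw [specialize_revAlt, specialize_single]) hi hj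
  · exact (h.2 t ht).2.not_isPos b (by rw [specialize_revAlt, specialize_single]) hi hj

/-- If every appended letter shortens, then appending the same letters in reverse order is a chain
of lengthening steps leading back to `w`. -/
lemma IsLift.mul_revAlt {n : ℕ} {i j : b.support} {w : P.weylGroup}
    {Z : Matrix b.support b.support (Polynomial ℤ)}
    (hneg : ∀ t < n, ¬ b.IsPos (P.weylGroupToPerm
      (w * altProd (simpleRefl b i) (simpleRefl b j) t) (if Even t then i else j : b.support)))
    (hZ : IsLift b (w * altProd (simpleRefl b i) (simpleRefl b j) n) Z) :
    IsLift b w (Z * revAlt (liftRefl b i) (liftRefl b j) n) := by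
  induction n generalizing i j w with
  | zero => simpa [altProd, revAlt] using hZ
  | succ n ih =>
    have h0 := hneg 0 (by lia)
    simp only [altProd, mul_one, Even.zero, if_true] at h0
    have h := ih (i := j) (j := i) (w := w * simpleRefl b i) (fun t ht => ?_)
      (by rwa [mul_assoc])
    · have := h.step i ((isPos_mul_ofIdx_self b w i).mpr h0)
      rwa [mul_simpleRefl_cancel, mul_assoc] at this
    · have := hneg (t + 1) (by lia)
      simp only [Nat.even_add_one, altProd, ← mul_assoc] at this
      split_ifs at this ⊢ <;> simpa using this

section Reduced

variable [P.IsReduced]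

lemma inversionCount_altProd {n : ℕ} {i j : b.support} {w : P.weylGroup}
    (hneg : ∀ t < n, ¬ b.IsPos (P.weylGroupToPerm
      (w * altProd (simpleRefl b i) (simpleRefl b j) t) (if Even t then i else j : b.support))) :
    inversionCount b (w * altProd (simpleRefl b i) (simpleRefl b j) n) + n =
      inversionCount b w := by
  induction n with
  | zero => simp [altProd]
  | succ n ih =>
    have h := inversionCount_mul_ofIdx_of_neg b (Subtype.prop _) (hneg n (by lia))
    rw [← ih fun t ht => hneg t (by lia), ← h, altProd_succ', ← mul_assoc]
    split_ifs <;> ring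

lemma inversionCount_le_mul_simpleRefl (w : P.weylGroup) (i : b.support) :
    inversionCount b w ≤ inversionCount b (w * simpleRefl b i) + 1 := by
  by_cases h : b.IsPos (P.weylGroupToPerm w i)
  · have := inversionCount_mul_ofIdx b i.2 h; lia
  · exact (inversionCount_mul_ofIdx_of_neg b i.2 h).ge

lemma inversionCount_le_altProd (n : ℕ) (i j : b.support) (w : P.weylGroup) :
    inversionCount b w ≤
      inversionCount b (w * altProd (simpleRefl b i) (simpleRefl b j) n) + n := by
  induction n generalizing i j w with
  | zero => simp [altProd]
  | succ n ih =>
    have h1 := inversionCount_le_mul_simpleRefl b w i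
    have h2 := ih j i (w * simpleRefl b i)
    rw [altProd, ← mul_assoc]
    lia

lemma altProd_simpleRefl_comm [P.IsRootSystem] {i j : b.support} {m : ℕ}
    (h : IsBraidPair (deformedCartan b) i j m) :
    altProd (simpleRefl b i) (simpleRefl b j) m = altProd (simpleRefl b j) (simpleRefl b i) m := by
  rw [altProd_eq_revAlt, altProd_eq_revAlt, revAlt_simpleRefl_comm b h]

lemma inversionCount_one : inversionCount b (1 : P.weylGroup) = 0 := by
  rw [inversionCount, Finset.card_eq_zero, Finset.eq_empty_iff_forall_notMem]
  intro k hk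
  rw [mem_inversions] at hk
  exact hk.2 (by simpa using hk.1)

variable [P.IsIrreducible] [P.IsRootSystem]

/-- Matsumoto's argument by induction on the number of inversions. If two reduced words of `w` end
in different letters `i`, `j`, then `w` is negative on both simple roots and so has reduced words
ending in either alternating word of full length; the braid relation identifies the two resulting
lifts. -/
lemma IsLift.unique {w : P.weylGroup} {X Y : Matrix b.support b.support (Polynomial ℤ)}
    (hX : IsLift b w X) (hY : IsLift b w Y) : X = Y := by
  induction hn : inversionCount b w using Nat.strong_induction_on generalizing w X Y with
  | h n ih =>
  have hcount : ∀ (u : P.weylGroup) (i : b.support), b.IsPos (P.weylGroupToPerm u i) →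
      w = u * simpleRefl b i → inversionCount b u < n := fun u i hu hw => by
    have := inversionCount_mul_ofIdx b i.2 hu
    rw [← hn, hw]; lia
  rcases hX.eq_or with ⟨rfl, rfl⟩ | ⟨u, X', i, hX', hi, hw, rfl⟩
  · rw [inversionCount_one] at hn
    rcases hY.eq_or with ⟨-, rfl⟩ | ⟨u, Y', j, hY', hj, hw, rfl⟩
    · rfl
    · have := hcount u j hj hw; lia
  · rcases hY.eq_or with ⟨rfl, rfl⟩ | ⟨u', Y', j, hY', hj, hw', rfl⟩
    · rw [inversionCount_one] at hn
      have := hcount u i hi hw; lia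
    · have hu : u = w * simpleRefl b i := by rw [hw, mul_simpleRefl_cancel]
      have hu' : u' = w * simpleRefl b j := by rw [hw', mul_simpleRefl_cancel]
      rcases eq_or_ne i j with rfl | hij
      · rw [ih _ (hcount u i hi hw) hX' (by rwa [hu, ← hu']) rfl]
      · obtain ⟨m, hm⟩ := exists_isBraidPair b hij
        have hwi : ¬ b.IsPos (P.weylGroupToPerm w i) := by
          rwa [hw, isPos_mul_ofIdx_self, not_not]
        have hwj : ¬ b.IsPos (P.weylGroupToPerm w j) := by
          rwa [hw', isPos_mul_ofIdx_self, not_not]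
        -- `Z` lifts what remains of `w` after the full alternating word is stripped; it is common
        -- to both sides.
        obtain ⟨Z, hZ⟩ := exists_isLift b
          (w * altProd (simpleRefl b i) (simpleRefl b j) (m + 1))
        have key : ∀ (k l : b.support) (v : P.weylGroup)
            (V : Matrix b.support b.support (Polynomial ℤ)),
            IsBraidPair (deformedCartan b) k l (m + 1) →
            ¬ b.IsPos (P.weylGroupToPerm w k) → ¬ b.IsPos (P.weylGroupToPerm w l) →
            v = w * simpleRefl b k → IsLift b v V → inversionCount b v < n →
            IsLift b (w * altProd (simpleRefl b k) (simpleRefl b l) (m + 1)) Z →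
            V * liftRefl b k = Z * revAlt (liftRefl b k) (liftRefl b l) (m + 1) := by
          intro k l v V hkl hk hl hv hV hlt hZ
          have hneg := fun t (ht : t < m + 1) => hkl.not_isPos_altProd b hk hl ht
          have hZ' : IsLift b v (Z * revAlt (liftRefl b l) (liftRefl b k) m) := by
            apply IsLift.mul_revAlt
            · intro t ht
              have := hneg (t + 1) (by lia)
              simp only [Nat.even_add_one, altProd, ← mul_assoc] at this
              rw [hv]
              split_ifs at this ⊢ <;> simpa using this
            · rw [hv, mul_assoc]; exact hZ
          rw [ih _ hlt hV hZ' rfl, revAlt, mul_assoc]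
        rw [key i j u X' hm hwi hwj hu hX' (hcount u i hi hw) hZ,
          key j i u' Y' hm.symm hwj hwi hu' hY' (hcount u' j hj hw')
            (by rwa [altProd_simpleRefl_comm b hm] at hZ), hm.1]

/-! ### Positivity -/

lemma NonnegPair.nonnegCoeff_mulVec {I : Type*} [Fintype I] [DecidableEq I]
    {i j : I} {v : I → Polynomial ℤ} (hv : NonnegPair i j v) {Z : Matrix I I (Polynomial ℤ)}
    (hi : ∀ k, NonnegCoeff (Z k i)) (hj : ∀ k, NonnegCoeff (Z k j)) (k : I) :
    NonnegCoeff (Z.mulVec v k) := by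
  obtain ⟨p, q, hp, hq, rfl⟩ := hv
  have : Z.mulVec (p • Pi.single i 1 + q • Pi.single j 1) k = p * Z k i + q * Z k j := by
    simp [Matrix.mulVec_add, Matrix.mulVec_smul]
  rw [this]
  exact (hp.mul (hi k)).add (hq.mul (hj k))

/-- Otherwise all `m + 1` letters would shorten `w`. By the braid relation the same product starts
with `s_i`, which lengthens `w`, and the remaining `m` letters cannot make up for that. -/
lemma exists_isPos_altProd {i j : b.support} {m : ℕ}
    (h : IsBraidPair (deformedCartan b) i j (m + 1)) {w : P.weylGroup}
    (hi : b.IsPos (P.weylGroupToPerm w i)) :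
    ∃ t < m + 1, b.IsPos (P.weylGroupToPerm
      (w * altProd (simpleRefl b j) (simpleRefl b i) t) (if Even t then j else i : b.support)) := by
  by_contra! hneg
  have h1 := inversionCount_altProd b hneg
  rw [← altProd_simpleRefl_comm b h, altProd, ← mul_assoc] at h1
  have h2 := inversionCount_le_altProd b m j i (w * simpleRefl b i)
  have h3 := inversionCount_mul_ofIdx b i.2 hi
  lia

/-- Let `j` be the last letter of a reduced word, so `j ≠ i`. Factor `w = v u` with `u` in the
dihedral group of `s_i`, `s_j` and `v` positive on both roots. The lift of `u` sends `e_i` to a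
nonnegative combination of `e_i` and `e_j`, and induction applies to these two columns of the lift
of `v`. -/
lemma IsLift.nonnegCoeff {w : P.weylGroup} {X : Matrix b.support b.support (Polynomial ℤ)}
    (hX : IsLift b w X) {i : b.support} (hi : b.IsPos (P.weylGroupToPerm w i)) (k : b.support) :
    NonnegCoeff (X k i) := by
  induction hn : inversionCount b w using Nat.strong_induction_on generalizing w X i k with
  | h n ih =>
  rcases hX.eq_or with ⟨rfl, rfl⟩ | ⟨u, X', j, hX', hj, hw, -⟩
  · rw [Matrix.one_apply]
    split_ifs
    exacts [.one, .zero]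
  · have hwj : ¬ b.IsPos (P.weylGroupToPerm w j) := by rwa [hw, isPos_mul_ofIdx_self, not_not]
    have hij : i ≠ j := by rintro rfl; exact hwj hi
    obtain ⟨m, hm⟩ := exists_isBraidPair b hij
    have hex := exists_isPos_altProd b hm hi
    -- Strip alternating letters, starting with `s_j`, until the next one would lengthen the
    -- element.
    set t := Nat.find hex
    obtain ⟨htm, ht⟩ := Nat.find_spec hex
    have hneg : ∀ s < t, ¬ b.IsPos (P.weylGroupToPerm
        (w * altProd (simpleRefl b j) (simpleRefl b i) s)
          (if Even s then j else i : b.support)) :=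
      fun s hs hpos => Nat.find_min hex hs ⟨hs.trans htm, hpos⟩
    have ht0 : t ≠ 0 := by
      intro h0
      change b.IsPos (P.weylGroupToPerm (w * altProd _ _ t) (if Even t then j else i : b.support))
        at ht
      rw [h0] at ht
      exact hwj (by simpa [altProd] using ht)
    obtain ⟨s, hs⟩ := Nat.exists_eq_succ_of_ne_zero ht0
    -- The other simple root is the one stripped last; it was negative before, and stripping it
    -- makes it positive.
    have ht' : b.IsPos (P.weylGroupToPerm (w * altProd (simpleRefl b j) (simpleRefl b i) t)
        (if Even s then j else i : b.support)) := by
      have h1 := hneg s (by lia)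
      rw [hs, Nat.succ_eq_add_one, altProd_succ', ← mul_assoc]
      split_ifs at h1 ⊢ <;> rwa [isPos_mul_ofIdx_self]
    have hcount := inversionCount_altProd b hneg
    obtain ⟨Z, hZ⟩ := exists_isLift b (w * altProd (simpleRefl b j) (simpleRefl b i) t)
    have hposi : b.IsPos (P.weylGroupToPerm
        (w * altProd (simpleRefl b j) (simpleRefl b i) t) i) ∧ b.IsPos (P.weylGroupToPerm
        (w * altProd (simpleRefl b j) (simpleRefl b i) t) j) := by
      change b.IsPos (P.weylGroupToPerm (w * altProd _ _ t) (if Even t then j else i : b.support))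
        at ht
      have he : Even t ↔ ¬ Even s := by rw [hs, Nat.succ_eq_add_one, Nat.even_add_one]
      by_cases hes : Even s
      · rw [if_neg (by tauto)] at ht
        rw [if_pos hes] at ht'
        exact ⟨ht, ht'⟩
      · rw [if_pos (by tauto)] at ht
        rw [if_neg hes] at ht'
        exact ⟨ht', ht⟩
    have hXZ := hX.unique b (hZ.mul_revAlt b hneg)
    have : X k i = Z.mulVec ((revAlt (liftRefl b j) (liftRefl b i) t).mulVec (Pi.single i 1)) k := by
      rw [Matrix.mulVec_mulVec, ← hXZ]
      simp
    rw [this]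
    exact (hm.2 t htm).1.nonnegCoeff_mulVec
      (fun k => ih _ (by lia) hZ hposi.1 k rfl) (fun k => ih _ (by lia) hZ hposi.2 k rfl) k

/-- The product of deformed reflections along a reduced word is `1 - Q A` with `Q` having
nonnegative entries. -/
lemma IsLift.exists_eq_one_sub {w : P.weylGroup} {X : Matrix b.support b.support (Polynomial ℤ)}
    (hX : IsLift b w X) : ∃ Q : Matrix b.support b.support (Polynomial ℤ),
      (∀ i j, NonnegCoeff (Q i j)) ∧ X = 1 - Q * deformedCartan b := by
  induction hX with
  | one => exact ⟨0, fun _ _ => .zero, by simp⟩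
  | @step w X i hX hi ih =>
    obtain ⟨Q, hQ, hXQ⟩ := ih
    -- `X T_i = X - (X E_ii) A`, and `X E_ii` retains only the `i`-th column of `X`, which is
    -- nonnegative since `w α_i > 0`.
    refine ⟨Q + X * Matrix.single i i 1, fun k l => ?_, ?_⟩
    · refine (hQ k l).add (show NonnegCoeff ((X * Matrix.single i i 1 :
        Matrix b.support b.support (Polynomial ℤ)) k l) from ?_)
      rcases eq_or_ne l i with rfl | hl
      · simpa using hX.nonnegCoeff b hi k
      · rw [Matrix.mul_single_apply_of_ne]
        exacts [.zero, hl]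
    · rw [liftRefl, deformedReflection, mul_sub, mul_one, add_mul, ← mul_assoc]
      nth_rw 1 [hXQ]
      abel

/-- Each letter contributes `-X^{2 d_i}` to the determinant and one inversion to `w`, while `d` is
constant on Weyl orbits. Working up to associates discards the signs. -/
lemma IsLift.det {w : P.weylGroup} {X : Matrix b.support b.support (Polynomial ℤ)}
    (hX : IsLift b w X) : Associated X.det
      (Polynomial.X ^ (2 * ∑ k ∈ inversions b w, symmetrizerNat P k)) := by
  induction hX with
  | one =>
    have := inversionCount_one b
    rw [inversionCount, Finset.card_eq_zero] at this
    simp [this]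
  | @step w X i hX hi ih =>
    rw [sum_inversions_mul_ofIdx b i.2 hi _
      (fun k => symmetrizerNat_weylGroup (RootPairing.weylGroup.ofIdx P i) k),
      Matrix.det_mul, det_deformedReflection, deformedCartan_self, mul_add, pow_add]
    refine ih.mul_mul ?_
    rw [sub_add_cancel_left]
    exact Associated.neg_left (Associated.refl _)

/-! ### Multiplication by a simple reflection on the left -/

/-- Lifts grow on the right by definition; growth on the left is what allows conjugating `T_i` past
the lift of `w₀`. -/
lemma IsLift.simpleRefl_mul {u : P.weylGroup} {X : Matrix b.support b.support (Polynomial ℤ)}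
    (hX : IsLift b u X) {i : b.support} (hi : b.IsPos (P.weylGroupToPerm u⁻¹ i)) :
    IsLift b (simpleRefl b i * u) (liftRefl b i * X) := by
  induction hX with
  | one =>
    have := IsLift.one (b := b)
    simpa using this.step i (by simpa using RootPairing.Base.isPos_of_mem_support i.2)
  | @step u X j hX hj ih =>
    have hinv : (u * simpleRefl b j)⁻¹ = simpleRefl b j * u⁻¹ := by
      rw [mul_inv_rev, inv_eq_of_mul_eq_one_left (ofIdx_mul_self (P := P) (j : ι))]
    rw [hinv, weylGroupToPerm_mul, weylGroupToPerm_ofIdx] at hi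
    have hcancel : ∀ k, P.weylGroupToPerm u (P.weylGroupToPerm u⁻¹ k) = k := fun k => by
      rw [← weylGroupToPerm_mul, mul_inv_cancel]; simp
    have hcancel' : ∀ k, P.weylGroupToPerm u⁻¹ (P.weylGroupToPerm u k) = k := fun k => by
      rw [← weylGroupToPerm_mul, inv_mul_cancel]; simp
    -- The only positive root that `s_j` makes negative is `α_j`; that case would give `u α_j =
    -- -α_i`, against `hj`.
    have h1 : b.IsPos (P.weylGroupToPerm u⁻¹ i) := by
      set k := P.weylGroupToPerm u⁻¹ i with hk
      rcases eq_or_ne (P.reflectionPerm j k) j with h | h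
      · exfalso
        have hk' : k = P.reflectionPerm j j := by
          conv_rhs => rw [← h]
          rw [h]
          exact ((P.reflectionPerm j).symm_apply_eq.mpr h.symm).symm.trans (by simp)
        have := (weylGroupToPerm_reflectionPerm_self b u j).mp
          (by rw [← hk', hk, hcancel]; exact RootPairing.Base.isPos_of_mem_support i.2)
        exact this hj
      · simpa using hi.reflectionPerm j.2 h
    have h2 := ih h1
    rw [← mul_assoc, ← mul_assoc]
    refine h2.step j ?_
    rw [weylGroupToPerm_mul, weylGroupToPerm_ofIdx]
    refine hj.reflectionPerm i.2 fun h => ?_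
    rw [← h, hcancel'] at hi
    exact not_isPos_reflectionPerm_self b j.2 hi

end Reduced

end

end QuantumCartan

namespace QuantumCartan

noncomputable section

open scoped Classical

variable {ι K M N : Type*} [Fintype ι] [Field K] [CharZero K] [AddCommGroup M] [Module K M]
  [AddCommGroup N] [Module K N] {P : RootPairing ι K M N} [P.IsCrystallographic]
  (b : P.Base) [P.IsReduced] [P.IsRootSystem]

/-! ### The longest element -/

/-- An element with the most inversions is negative on every simple root, since otherwise a further
letter would add an inversion; hence it is negative on all positive roots. -/
lemma exists_isLongestElement : ∃ w : P.weylGroup, IsLongestElement b w := by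
  have hmem := Nat.sSup_mem (Set.range_nonempty (inversionCount b : P.weylGroup → ℕ))
    ⟨Fintype.card ι, by rintro _ ⟨w, rfl⟩; exact Finset.card_le_univ _⟩
  obtain ⟨w, hw⟩ := hmem
  have hmax : ∀ v, inversionCount b v ≤ inversionCount b w := fun v => by
    rw [hw]
    exact le_csSup ⟨Fintype.card ι, by rintro _ ⟨w, rfl⟩; exact Finset.card_le_univ _⟩ ⟨v, rfl⟩
  have hsimple : ∀ i ∈ b.support, ¬ b.IsPos (P.weylGroupToPerm w i) := fun i hi hpos => by
    have h1 := inversionCount_mul_ofIdx b hi hpos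
    have h2 := hmax (w * RootPairing.weylGroup.ofIdx P i)
    lia
  refine ⟨w, fun k hk => ?_⟩
  exact hk.induction_on_add (p := fun k => ¬ b.IsPos (P.weylGroupToPerm w k)) hsimple
    fun i j k hk hi hj => not_isPos_of_root_eq b zero_le_one zero_le_one (by simpa using hk) hi
      (hsimple j hj)

lemma longestElement_spec : IsLongestElement b (longestElement b) :=
  Classical.epsilon_spec (exists_isLongestElement b)

lemma isPos_longestElement_iff (k : ι) :
    b.IsPos (P.weylGroupToPerm (longestElement b) k) ↔ ¬ b.IsPos k := by
  refine ⟨fun h hk => longestElement_spec b k hk h, fun h => ?_⟩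
  have h1 : b.IsPos (P.reflectionPerm k k) := by
    rwa [isPos_of_root_eq_neg b (root_reflectionPerm_self k)]
  have h2 := longestElement_spec b _ h1
  rwa [weylGroupToPerm_reflectionPerm_self, not_not] at h2

lemma IsPos.mem_support_or_exists_add {k : ι} (hk : b.IsPos k) :
    k ∈ b.support ∨ ∃ i j, b.IsPos i ∧ b.IsPos j ∧ P.root k = P.root i + P.root j := by
  suffices h : b.IsPos k ∧
      (k ∈ b.support ∨ ∃ i j, b.IsPos i ∧ b.IsPos j ∧ P.root k = P.root i + P.root j) from h.2
  refine hk.induction_on_add (p := fun k => b.IsPos k ∧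
    (k ∈ b.support ∨ ∃ i j, b.IsPos i ∧ b.IsPos j ∧ P.root k = P.root i + P.root j))
    (fun i hi => ⟨RootPairing.Base.isPos_of_mem_support hi, Or.inl hi⟩) fun i j k hk hi hj => ?_
  have hj' := RootPairing.Base.isPos_of_mem_support hj
  exact ⟨hi.1.add hj' hk, Or.inr ⟨i, j, hi.1, hj', hk⟩⟩

/-- If the positive root `-w₀ α_i` were a sum of two positive roots, then applying `w₀⁻¹` would
write `α_i`, of height one, as a sum of two positive roots. -/
lemma exists_longestElement_smul_root (i : b.support) :
    ∃ j : b.support, longestElement b • P.root i = - P.root j := by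
  set w := longestElement b
  set k := P.weylGroupToPerm w i
  have hk : b.IsPos (P.reflectionPerm k k) := by
    rw [isPos_of_root_eq_neg b (root_reflectionPerm_self k), isPos_longestElement_iff, not_not]
    exact RootPairing.Base.isPos_of_mem_support i.2
  have hroot : P.root (P.reflectionPerm k k) = - (w • P.root i) := by
    rw [root_reflectionPerm_self, P.weylGroup_apply_root]
  have hneg : ∀ l, b.IsPos l → ¬ b.IsPos (P.weylGroupToPerm w⁻¹ l) := fun l hl h => by
    have := longestElement_spec b _ h
    rw [← weylGroupToPerm_mul, mul_inv_cancel] at this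
    exact this (by simpa using hl)
  rcases IsPos.mem_support_or_exists_add b hk with h | ⟨l, m, hl, hm, h⟩
  · exact ⟨⟨_, h⟩, by rw [hroot, neg_neg]⟩
  · exfalso
    have h1 := hneg l hl
    have h2 := hneg m hm
    have h3 : P.root i = - P.root (P.weylGroupToPerm w⁻¹ l) - P.root (P.weylGroupToPerm w⁻¹ m) := by
      rw [← P.weylGroup_apply_root, ← P.weylGroup_apply_root, sub_eq_add_neg, ← neg_add, ← smul_add,
        ← h, hroot, smul_neg, neg_neg, inv_smul_smul]
    have h4 : b.height i = - b.height (P.weylGroupToPerm w⁻¹ l) -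
        b.height (P.weylGroupToPerm w⁻¹ m) := by
      apply Int.cast_injective (α := K)
      push_cast
      simp only [← heightForm_root]
      rw [h3, map_sub, map_neg]
    rw [RootPairing.Base.height_one_of_mem_support i.2] at h4
    rw [RootPairing.Base.isPos_iff'] at h1 h2
    lia

lemma longestElement_smul_root (i : b.support) :
    longestElement b • P.root i = - P.root (starInvolution b i) :=
  Classical.epsilon_spec (exists_longestElement_smul_root b i)

lemma root_starInvolution (i : b.support) :
    P.root (starInvolution b i) = - (longestElement b • P.root i) := by
  rw [longestElement_smul_root, neg_neg]

lemma form_starInvolution (i j : b.support) :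
    (P.posRootForm ℤ).form (P.root (starInvolution b i)) (P.root (starInvolution b j)) =
      (P.posRootForm ℤ).form (P.root i) (P.root j) := by
  rw [root_starInvolution, root_starInvolution, map_neg, LinearMap.map_neg₂, neg_neg]
  exact RootPairing.InvariantForm.apply_weylGroup_smul P
    (B := (P.posRootForm ℤ).toInvariantForm) _ _ _

lemma sqLength_starInvolution (i : b.support) :
    sqLength P (starInvolution b i) = sqLength P i := by
  apply Int.cast_injective (α := K)
  rw [sqLength_cast, sqLength_cast, form_starInvolution]

lemma symmetrizer_starInvolution (i : b.support) :
    symmetrizer P (starInvolution b i) = symmetrizer P i := by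
  rw [symmetrizer, sqLength_starInvolution, symmetrizer]

lemma cartanEntry_starInvolution (i j : b.support) :
    cartanEntry b (starInvolution b i) (starInvolution b j) = cartanEntry b i j := by
  have key : ∀ i j : b.support, 2 * (P.posRootForm ℤ).form (P.root j) (P.root i) =
      (cartanEntry b i j : K) * sqLength P i := fun i j => by
    rw [(P.posRootForm ℤ).two_mul_apply_root_root, ← sqLength_cast]
    congr 1
    exact (P.algebraMap_pairingIn ℤ j i).symm
  have h1 := key (starInvolution b i) (starInvolution b j)
  rw [form_starInvolution, key i j, sqLength_starInvolution] at h1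
  have h2 : (sqLength P i : K) ≠ 0 := by exact_mod_cast (sqLength_pos (P := P) (i : ι)).ne'
  exact_mod_cast (mul_right_cancel₀ h2 h1).symm

lemma longestElement_mul_simpleRefl (i : b.support) :
    longestElement b * simpleRefl b i = simpleRefl b (starInvolution b i) * longestElement b := by
  apply weylGroup_ext_base b
  intro j
  rw [mul_smul, mul_smul, simpleRefl_smul_root, smul_sub, smul_zsmul_comm',
    longestElement_smul_root, longestElement_smul_root, smul_neg, smul_neg,
    simpleRefl_smul_root, cartanEntry_starInvolution]
  module

variable [P.IsIrreducible]

/-- The square preserves positivity, so no reduced word for it can have a last letter. -/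
lemma longestElement_mul_self : longestElement b * longestElement b = 1 := by
  obtain ⟨X, hX⟩ := exists_isLift b (longestElement b * longestElement b)
  rcases hX.eq_or with h | ⟨u, -, i, -, hi, hw, -⟩
  · exact h.1
  · have h1 : ¬ b.IsPos (P.weylGroupToPerm (u * simpleRefl b i) i) := by
      rwa [isPos_mul_ofIdx_self, not_not]
    rw [← hw, weylGroupToPerm_mul, isPos_longestElement_iff, isPos_longestElement_iff, not_not] at h1
    exact absurd (RootPairing.Base.isPos_of_mem_support i.2) h1

lemma starInvolution_starInvolution (i : b.support) :
    starInvolution b (starInvolution b i) = i := by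
  apply Subtype.ext
  apply P.root.injective
  rw [root_starInvolution, root_starInvolution, smul_neg, neg_neg, ← mul_smul,
    longestElement_mul_self, one_smul]

lemma deformedCartan_starInvolution (i j : b.support) :
    deformedCartan b (starInvolution b i) (starInvolution b j) = deformedCartan b i j := by
  have hd : ∀ i : b.support, symmetrizerNat P (starInvolution b i) = symmetrizerNat P i :=
    fun i => by rw [symmetrizerNat, symmetrizer_starInvolution, symmetrizerNat]
  rcases eq_or_ne i j with rfl | h
  · rw [deformedCartan_self, deformedCartan_self, hd]
  · have h' : starInvolution b i ≠ starInvolution b j := fun e => h <| by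
      rw [← starInvolution_starInvolution b i, e, starInvolution_starInvolution]
    rw [deformedCartan_of_ne b h, deformedCartan_of_ne b h', hd]
    simp only [cartanNat, cartanEntry_starInvolution]

variable {b} in
-- If `Y` lifts `w₀ s_i`, then `w₀ = (w₀ s_i) s_i = s_{i^*} (w₀ s_i)` gives, by uniqueness, `X = Y
-- T_i = T_{i^*} Y`.
lemma IsLift.mul_liftRefl_longestElement {X : Matrix b.support b.support (Polynomial ℤ)}
    (hX : IsLift b (longestElement b) X) (i : b.support) :
    X * liftRefl b i = liftRefl b (starInvolution b i) * X := by
  obtain ⟨Y, hY⟩ := exists_isLift b (longestElement b * simpleRefl b i)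
  have hi := RootPairing.Base.isPos_of_mem_support i.2
  have h1 := hY.step i (by
    rw [isPos_mul_ofIdx_self, isPos_longestElement_iff, not_not]; exact hi)
  rw [mul_simpleRefl_cancel] at h1
  have h2 : b.IsPos (P.weylGroupToPerm (longestElement b * simpleRefl b i)⁻¹
      (starInvolution b i)) := by
    have : P.weylGroupToPerm (longestElement b * simpleRefl b i)⁻¹ (starInvolution b i) = i := by
      apply P.root.injective
      rw [← P.weylGroup_apply_root, inv_smul_eq_iff, mul_smul, simpleRefl_smul_root,
        cartanEntry_self, smul_sub, smul_zsmul_comm', longestElement_smul_root]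
      module
    rwa [this]
  have h3 := hY.simpleRefl_mul b h2
  rw [← mul_assoc, ← longestElement_mul_simpleRefl, mul_simpleRefl_cancel] at h3
  rw [hX.unique b h1, mul_assoc, ← mul_assoc _ Y, h3.unique b h1]
  rw [mul_assoc]

lemma deformedCartan_ne_zero {i j : b.support} (h : cartanEntry b i j ≠ 0) :
    deformedCartan b i j ≠ 0 := fun h0 => h <| by
  rw [← deformedCartan_eval_one, h0, Polynomial.eval_zero]

variable {b} in
-- This is the commutation relation with the identity cancelled, `X E_ii A = E_{i^*i^*} A X`, read
-- entrywise.
lemma IsLift.longestElement_apply {X : Matrix b.support b.support (Polynomial ℤ)}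
    (hX : IsLift b (longestElement b) X) (i k l : b.support) :
    X k i * deformedCartan b i l = if k = starInvolution b i then
      ∑ m, deformedCartan b (starInvolution b i) m * X m l else 0 := by
  have h := hX.mul_liftRefl_longestElement i
  rw [liftRefl, liftRefl, deformedReflection, deformedReflection, mul_sub, sub_mul, mul_one,
    one_mul, sub_right_inj, mul_assoc] at h
  have h1 := congrFun₂ h k l
  rw [single_mul_apply' (deformedCartan b * X), Matrix.mul_apply, Matrix.mul_apply] at h1
  rw [← h1]
  simp [single_mul_apply']

variable {b} in
lemma IsLift.longestElement_apply_of_ne {X : Matrix b.support b.support (Polynomial ℤ)}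
    (hX : IsLift b (longestElement b) X) {i k : b.support} (h : k ≠ starInvolution b i) :
    X k i = 0 := by
  have h1 := hX.longestElement_apply i k i
  rw [if_neg h] at h1
  exact (mul_eq_zero.mp h1).resolve_right
    (deformedCartan_ne_zero b (by rw [cartanEntry_self]; norm_num))

variable {b} in
-- The commutation relation equates these entries for adjacent nodes, where `A` is nonzero, and the
-- Dynkin diagram is connected.
lemma IsLift.longestElement_apply_star {X : Matrix b.support b.support (Polynomial ℤ)}
    (hX : IsLift b (longestElement b) X) (i j : b.support) :
    X (starInvolution b j) j = X (starInvolution b i) i := by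
  refine b.induction_on_cartanMatrix (i := i)
    (fun l => X (starInvolution b l) l = X (starInvolution b i) i) rfl fun k l hk hkl => ?_
  have h1 := hX.longestElement_apply k (starInvolution b k) l
  rw [if_pos rfl, Finset.sum_eq_single (starInvolution b l), deformedCartan_starInvolution, mul_comm,
    mul_right_inj' (deformedCartan_ne_zero b hkl)] at h1
  · rw [← h1, hk]
  · intro m _ hm
    rw [hX.longestElement_apply_of_ne hm, mul_zero]
  · simp

variable {b} in
lemma IsLift.longestElement_eval_one {X : Matrix b.support b.support (Polynomial ℤ)}
    (hX : IsLift b (longestElement b) X) (i : b.support) :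
    (X (starInvolution b i) i).eval 1 = -1 := by
  have : IsAddTorsionFree M := .of_isTorsionFree K M
  have h := hX.specialize b (Pi.single i 1)
  rw [specialize_single, longestElement_smul_root, QuantumCartan.specialize,
    Finset.sum_eq_single (starInvolution b i)] at h
  · rw [← neg_one_zsmul (P.root (starInvolution b i))] at h
    have := smul_left_injective ℤ (P.ne_zero (starInvolution b i)) h
    simpa using this
  · intro k _ hk
    simp [hX.longestElement_apply_of_ne hk]
  · simp

lemma two_mul_sum_inversions_longestElement :
    2 * ∑ k ∈ inversions b (longestElement b), symmetrizerNat P k = ∑ k, symmetrizerNat P k := by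
  have h1 : inversions b (longestElement b) = Finset.univ.filter fun k => b.IsPos k := by
    ext k
    rw [mem_inversions, isPos_longestElement_iff, not_not, Finset.mem_filter]
    simp
  rw [h1, ← Finset.sum_filter_add_sum_filter_not Finset.univ (fun k => b.IsPos k), two_mul]
  congr 1
  have hinv : ∀ k, P.reflectionPerm (P.reflectionPerm k k) (P.reflectionPerm k k) = k := fun k =>
    P.root.injective (by simp only [root_reflectionPerm_self, neg_neg])
  refine Finset.sum_bij' (fun k _ => P.reflectionPerm k k) (fun k _ => P.reflectionPerm k k)
    ?_ ?_ (fun k _ => hinv k) (fun k _ => hinv k)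
    (fun k _ => (symmetrizerNat_weylGroup (RootPairing.weylGroup.ofIdx P k) k).symm)
  · intro k hk
    rw [Finset.mem_filter] at hk ⊢
    refine ⟨Finset.mem_univ _, ?_⟩
    rw [isPos_of_root_eq_neg b (root_reflectionPerm_self k), not_not]
    exact hk.2
  · intro k hk
    rw [Finset.mem_filter] at hk ⊢
    refine ⟨Finset.mem_univ _, ?_⟩
    rw [isPos_of_root_eq_neg b (root_reflectionPerm_self k)]
    exact hk.2

/-! ### The lift of the longest element as a monomial times a permutation matrix -/

/-- The permutation matrix of the involution `i ↦ i^*`. -/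
def starMatrix (R : Type*) [Zero R] [One R] : Matrix b.support b.support R :=
  Matrix.of fun i j => if i = starInvolution b j then 1 else 0

/-- The involution `i ↦ i^*` as a permutation. -/
def starPerm : Equiv.Perm b.support where
  toFun := starInvolution b
  invFun := starInvolution b
  left_inv := starInvolution_starInvolution b
  right_inv := starInvolution_starInvolution b

lemma starMatrix_eq_permMatrix (R : Type*) [Zero R] [One R] :
    starMatrix b R = (starPerm b).permMatrix R := by
  ext i j
  rw [starMatrix, Matrix.of_apply, Equiv.Perm.permMatrix, PEquiv.toMatrix_apply]
  have : i = starInvolution b j ↔ starInvolution b i = j :=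
    ⟨fun h => by rw [h, starInvolution_starInvolution],
      fun h => by rw [← h, starInvolution_starInvolution]⟩
  simp [starPerm, this, eq_comm]

lemma eq_neg_X_pow_of_pow_associated {p : Polynomial ℤ} {n m : ℕ} (hn : n ≠ 0)
    (h : Associated (p ^ n) (Polynomial.X ^ m)) (h1 : p.eval 1 = -1) :
    ∃ k, k * n = m ∧ p = - Polynomial.X ^ k := by
  obtain ⟨k, -, hk⟩ := (dvd_prime_pow Polynomial.prime_X m).mp ((dvd_pow_self p hn).trans h.dvd)
  obtain ⟨u, hu⟩ := hk.symm
  obtain ⟨r, -, hr⟩ := Polynomial.isUnit_iff.mp u.isUnit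
  have hr1 : r = -1 := by
    rw [← hu, ← hr] at h1
    simpa using h1
  refine ⟨k, ?_, by rw [← hu, ← hr, hr1]; simp⟩
  have h2 := (hk.pow_pow (n := n)).symm.trans h
  rw [← pow_mul] at h2
  have h3 := Polynomial.natDegree_eq_of_degree_eq (Polynomial.degree_eq_degree_of_associated h2)
  simpa using h3

/-- The lift of `w₀` is a scalar multiple of `σ`. Its determinant makes the scalar a unit times a
power of `X`, the value at `X = 1` makes the unit `-1`, and counting degrees determines the
exponent. -/
theorem exists_mul_deformedCartan [Nonempty b.support] :
    ∃ n : ℕ, n * Fintype.card b.support = ∑ k, symmetrizerNat P k ∧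
      ∃ Q : Matrix b.support b.support (Polynomial ℤ), (∀ i j, NonnegCoeff (Q i j)) ∧
        Q * deformedCartan b = 1 + (Polynomial.X ^ n : Polynomial ℤ) • starMatrix b _ := by
  obtain ⟨X, hX⟩ := exists_isLift b (longestElement b)
  obtain ⟨Q, hQ, hXQ⟩ := hX.exists_eq_one_sub
  obtain ⟨i⟩ := (inferInstance : Nonempty b.support)
  have hXs : X = X (starInvolution b i) i • starMatrix b _ := by
    ext1 k l
    rw [Matrix.smul_apply, starMatrix, Matrix.of_apply]
    split_ifs with h
    · rw [h, hX.longestElement_apply_star i l, smul_eq_mul, mul_one]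
    · rw [hX.longestElement_apply_of_ne h, smul_zero]
  have hdet := hX.det b
  rw [two_mul_sum_inversions_longestElement] at hdet
  have hdet' : Associated (X (starInvolution b i) i ^ Fintype.card b.support) X.det := by
    conv_rhs => rw [hXs]
    rw [Matrix.det_smul, starMatrix_eq_permMatrix, Matrix.det_permutation]
    rcases Int.units_eq_one_or (Equiv.Perm.sign (starPerm b)) with h | h <;> rw [h]
    · simp
    · simp
  obtain ⟨n, hn, hn'⟩ := eq_neg_X_pow_of_pow_associated Fintype.card_ne_zero (hdet'.trans hdet)
    (hX.longestElement_eval_one i)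
  refine ⟨n, hn, Q, hQ, ?_⟩
  rw [hn', hXQ, neg_smul] at hXs
  rw [← sub_eq_iff_eq_add', ← neg_inj, neg_sub, hXs]

end

end QuantumCartan

namespace QuantumCartan

noncomputable section

open scoped Classical

variable {ι K M N : Type*} [Fintype ι] [Field K] [CharZero K] [AddCommGroup M] [Module K M]
  [AddCommGroup N] [Module K N] {P : RootPairing ι K M N} [P.IsCrystallographic]

/-! ### The sum of the squared lengths of the roots -/

section Casimir

/-- The endomorphism `x ↦ ∑_β (β, x) β`. -/
def rootSum (P : RootPairing ι K M N) [P.IsCrystallographic] : M →ₗ[K] M :=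
  ∑ k, ((P.posRootForm ℤ).form (P.root k)).smulRight (P.root k)

lemma rootSum_apply (x : M) :
    rootSum P x = ∑ k, (P.posRootForm ℤ).form (P.root k) x • P.root k := by
  simp [rootSum]

lemma rootSum_reflection (i : ι) (x : M) :
    rootSum P (P.reflection i x) = P.reflection i (rootSum P x) := by
  rw [rootSum_apply, rootSum_apply, map_sum, ← Equiv.sum_comp (P.reflectionPerm i)]
  refine Finset.sum_congr rfl fun k _ => ?_
  rw [map_smul, RootPairing.root_reflectionPerm]
  congr 1
  exact (P.posRootForm ℤ).isOrthogonal_reflection i (P.root k) x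

variable [P.IsIrreducible] [P.IsRootSystem]

/-- A form of Schur's lemma. The operator commutes with reflections, so it preserves the line on
which `s_i` acts by `-1`. The resulting eigenspace is nonzero and reflection-invariant, hence
everything. -/
lemma exists_rootSum_eq_smul (i : ι) : ∃ c : K, ∀ x, rootSum P x = c • x := by
  set c : K := 2⁻¹ * P.coroot' i (rootSum P (P.root i)) with hc
  have h1 : rootSum P (P.root i) = c • P.root i := by
    have h := rootSum_reflection (P := P) i (P.root i)
    rw [RootPairing.reflection_apply_self, map_neg, RootPairing.reflection_apply] at h
    rw [hc, mul_smul, eq_inv_smul_iff₀ two_ne_zero, two_smul]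
    rw [neg_eq_iff_eq_neg, neg_sub] at h
    nth_rw 1 [h]
    abel
  refine ⟨c, ?_⟩
  set q : Submodule K M := LinearMap.ker (rootSum P - c • LinearMap.id) with hq
  have hmem : ∀ x, x ∈ q ↔ rootSum P x = c • x := fun x => by
    rw [hq, LinearMap.mem_ker]; simp [sub_eq_zero]
  have htop : q = ⊤ := by
    refine RootPairing.IsIrreducible.eq_top_of_invtSubmodule_reflection (P := P) q (fun j => ?_) ?_
    · rw [Module.End.mem_invtSubmodule]
      intro x hx
      rw [hmem] at hx
      rw [Submodule.mem_comap, hmem]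
      exact (rootSum_reflection j x).trans (by rw [hx, map_smul]; rfl)
    · exact q.ne_bot_iff.mpr ⟨P.root i, (hmem _).mpr h1, P.ne_zero i⟩
  intro x
  rw [← hmem, htop]
  exact Submodule.mem_top

/-- The trace of the scalar operator is both `c · rank` and `∑ (β, β)`. The scalar is found by
pairing its value at the root `i` with that root, using `2 (β, α) = ⟨β, α^∨⟩ (α, α)`. -/
lemma four_mul_sum_sqLength (b : P.Base) (i : ι) :
    4 * ∑ k, sqLength P k =
      (∑ k, P.pairingIn ℤ k i ^ 2) * sqLength P i * Fintype.card b.support := by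
  obtain ⟨c, hc⟩ := exists_rootSum_eq_smul (P := P) i
  have : Module.Finite K M := .of_basis b.toWeightBasis
  have htr : LinearMap.trace K M (rootSum P) = ∑ k, (sqLength P k : K) := by
    rw [rootSum, map_sum]
    exact Finset.sum_congr rfl fun k _ => by rw [LinearMap.trace_smulRight, sqLength_cast]
  have htr' : LinearMap.trace K M (rootSum P) = c * Fintype.card b.support := by
    have : rootSum P = c • LinearMap.id := LinearMap.ext fun x => by rw [hc]; rfl
    rw [this, map_smul, LinearMap.trace_id, Module.finrank_eq_card_basis b.toWeightBasis,
      smul_eq_mul]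
  have hi : (sqLength P i : K) ≠ 0 := by exact_mod_cast (sqLength_pos (P := P) i).ne'
  have hform : 4 * c * sqLength P i = (∑ k, (P.pairingIn ℤ k i : K) ^ 2) * sqLength P i ^ 2 := by
    have h := congrArg ((P.posRootForm ℤ).form (P.root i)) (hc (P.root i))
    rw [rootSum_apply, map_sum, map_smul, smul_eq_mul, ← sqLength_cast] at h
    rw [mul_assoc, ← h, Finset.mul_sum, Finset.sum_mul]
    refine Finset.sum_congr rfl fun k _ => ?_
    have h2 := (P.posRootForm ℤ).two_mul_apply_root_root k i
    rw [← sqLength_cast, ← P.algebraMap_pairingIn ℤ] at h2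
    have h3 := (P.posRootForm ℤ).symm.eq (P.root k) (P.root i)
    rw [RingHom.id_apply] at h3
    rw [map_smul, smul_eq_mul, ← h3, ← mul_pow]
    change _ = ((algebraMap ℤ K) _ * _) ^ 2
    rw [← h2]
    ring
  have hfin : (4 : K) * ∑ k, (sqLength P k : K) =
      (∑ k, (P.pairingIn ℤ k i : K) ^ 2) * sqLength P i * Fintype.card b.support := by
    rw [← htr, htr']
    apply mul_right_cancel₀ hi
    linear_combination (Fintype.card b.support : K) * hform
  exact_mod_cast hfin

end Casimir

/-! ### The highest root -/

section Highest

variable (b : P.Base)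

/-- The field `K` carries no order, so nonnegativity on the positive cone is expressed as being a
natural number. -/
lemma exists_natCast_of_mem_closure {f : M →ₗ[K] K}
    (hf : ∀ i ∈ b.support, ∃ n : ℕ, f (P.root i) = n) {x : M}
    (hx : x ∈ AddSubmonoid.closure (P.root '' b.support)) : ∃ n : ℕ, f x = n := by
  induction hx using AddSubmonoid.closure_induction with
  | mem x hx =>
    obtain ⟨i, hi, rfl⟩ := hx
    exact hf i hi
  | zero => exact ⟨0, by simp⟩
  | add x y _ _ hx hy =>
    obtain ⟨m, hm⟩ := hx
    obtain ⟨n, hn⟩ := hy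
    exact ⟨m + n, by rw [map_add, hm, hn]; push_cast; rfl⟩

variable [P.IsRootSystem]

lemma exists_heightForm_eq_natCast {x : M}
    (hx : x ∈ AddSubmonoid.closure (P.root '' b.support)) : ∃ n : ℕ, heightForm b x = n :=
  exists_natCast_of_mem_closure b (fun i hi => ⟨1, by
    rw [heightForm_root, RootPairing.Base.height_one_of_mem_support hi]; simp⟩) hx

lemma root_mem_closure_iff {k : ι} :
    P.root k ∈ AddSubmonoid.closure (P.root '' b.support) ↔ b.IsPos k := by
  have key : ∀ l, P.root l ∈ AddSubmonoid.closure (P.root '' b.support) → b.IsPos l := by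
    intro l hl
    obtain ⟨n, hn⟩ := exists_heightForm_eq_natCast b hl
    rw [heightForm_root] at hn
    have : b.height l = n := by exact_mod_cast hn
    rw [RootPairing.Base.isPos_iff']
    lia
  refine ⟨key k, fun hk => (b.root_mem_or_neg_mem k).resolve_right fun h => ?_⟩
  rw [← root_reflectionPerm_self] at h
  exact (isPos_of_root_eq_neg b (root_reflectionPerm_self k)).mp (key _ h) hk

lemma height_le_of_sub_mem_closure {k l : ι}
    (h : P.root l - P.root k ∈ AddSubmonoid.closure (P.root '' b.support)) :
    b.height k ≤ b.height l := by
  obtain ⟨n, hn⟩ := exists_heightForm_eq_natCast b h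
  rw [map_sub, heightForm_root, heightForm_root] at hn
  have : b.height l - b.height k = n := by exact_mod_cast hn
  lia

/-- A root which cannot be raised in the dominance order. -/
def IsMaximalRoot (k : ι) : Prop :=
  ∀ l, P.root l - P.root k ∈ AddSubmonoid.closure (P.root '' b.support) → b.height l ≤ b.height k

lemma exists_isMaximalRoot_ge (k : ι) : ∃ l, IsMaximalRoot b l ∧
    P.root l - P.root k ∈ AddSubmonoid.closure (P.root '' b.support) := by
  obtain ⟨l, hl, hmax⟩ := (Finset.univ.filter fun l => P.root l - P.root k ∈
    AddSubmonoid.closure (P.root '' b.support)).exists_max_image b.height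
      ⟨k, by simp⟩
  rw [Finset.mem_filter] at hl
  refine ⟨l, fun m hm => hmax m ?_, hl.2⟩
  rw [Finset.mem_filter]
  refine ⟨Finset.mem_univ _, ?_⟩
  have := add_mem hm hl.2
  rwa [sub_add_sub_cancel] at this

variable {b}

lemma IsMaximalRoot.isPos {k : ι} (hk : IsMaximalRoot b k) : b.IsPos k := by
  by_contra hneg
  have h1 : b.IsPos (P.reflectionPerm k k) := by
    rwa [isPos_of_root_eq_neg b (root_reflectionPerm_self k)]
  have h2 := (root_mem_closure_iff b).mpr h1
  have h3 := hk (P.reflectionPerm k k) (by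
    have := add_mem h2 h2
    nth_rw 2 [root_reflectionPerm_self] at this
    rwa [← sub_eq_add_neg] at this)
  rw [RootPairing.Base.isPos_iff'] at h1 hneg
  lia

lemma IsMaximalRoot.pairingIn_nonneg {k i : ι} (hk : IsMaximalRoot b k) (hi : i ∈ b.support) :
    0 ≤ P.pairingIn ℤ k i := by
  by_contra! hneg
  have hpos := hk.isPos
  have hpos_i := RootPairing.Base.isPos_of_mem_support hi
  have hne : P.root k ≠ - P.root i := fun h => by
    rw [isPos_of_root_eq_neg b h] at hpos
    exact hpos hpos_i
  obtain ⟨l, hl⟩ := P.root_add_root_mem_of_pairingIn_neg hneg hne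
  have h1 := hk l (by rw [hl, add_sub_cancel_left]; exact (root_mem_closure_iff b).mpr hpos_i)
  rw [b.height_add hl, RootPairing.Base.height_one_of_mem_support hi] at h1
  lia

variable (b) in
/-- A root pairing nonnegatively with all simple coroots. -/
def IsDominantRoot (k : ι) : Prop := ∀ i ∈ b.support, 0 ≤ P.pairingIn ℤ k i

lemma IsMaximalRoot.isDominantRoot {k : ι} (hk : IsMaximalRoot b k) : IsDominantRoot b k :=
  fun _ hi => hk.pairingIn_nonneg hi

lemma IsDominantRoot.two_mul_form_eq_natCast {k : ι} (hk : IsDominantRoot b k) {x : M}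
    (hx : x ∈ AddSubmonoid.closure (P.root '' b.support)) :
    ∃ n : ℕ, 2 * (P.posRootForm ℤ).form (P.root k) x = n := by
  have hf : ∀ i ∈ b.support, ∃ n : ℕ,
      ((2 : K) • (P.posRootForm ℤ).form (P.root k)) (P.root i) = n := fun i hi => by
    refine ⟨(P.pairingIn ℤ k i * sqLength P i).toNat, ?_⟩
    have h2 := (P.posRootForm ℤ).two_mul_apply_root_root k i
    rw [← sqLength_cast, ← P.algebraMap_pairingIn ℤ] at h2
    rw [LinearMap.smul_apply, smul_eq_mul, h2, ← Int.cast_natCast, Int.toNat_of_nonneg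
      (mul_nonneg (hk i hi) (sqLength_pos i).le)]
    push_cast
    rfl
  obtain ⟨n, hn⟩ := exists_natCast_of_mem_closure b hf hx
  exact ⟨n, by simpa using hn⟩

/-- `(l, l) - (k, k) = (k, l - k) + (l, l - k)`, and dominance makes both terms nonnegative. -/
lemma IsDominantRoot.sqLength_le {k l : ι} (hk : IsDominantRoot b k) (hl : IsDominantRoot b l)
    (h : P.root l - P.root k ∈ AddSubmonoid.closure (P.root '' b.support)) :
    sqLength P k ≤ sqLength P l := by
  obtain ⟨m, hm⟩ := hk.two_mul_form_eq_natCast h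
  obtain ⟨n, hn⟩ := hl.two_mul_form_eq_natCast h
  have h3 := (P.posRootForm ℤ).symm.eq (P.root k) (P.root l)
  rw [RingHom.id_apply] at h3
  rw [map_sub, ← sqLength_cast] at hm hn
  rw [h3] at hm
  have : 2 * sqLength P l - 2 * sqLength P k = ((m + n : ℕ) : ℤ) := by
    apply Int.cast_injective (α := K)
    push_cast
    linear_combination hm + hn
  lia

/-- Take a root of greatest height among those of the given length: a negative pairing with a simple
coroot would let the simple reflection raise it. -/
lemma exists_isDominantRoot_sqLength_eq (b : P.Base) (k : ι) :
    ∃ l, IsDominantRoot b l ∧ sqLength P l = sqLength P k := by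
  obtain ⟨l, hl, hmax⟩ := (Finset.univ.filter fun l => sqLength P l = sqLength P k).exists_max_image
    b.height ⟨k, by simp⟩
  rw [Finset.mem_filter] at hl
  refine ⟨l, fun i hi => ?_, hl.2⟩
  by_contra! hneg
  have h1 := hmax (P.reflectionPerm i l) (by
    rw [Finset.mem_filter]
    exact ⟨Finset.mem_univ _,
      (sqLength_weylGroup (RootPairing.weylGroup.ofIdx P i) l).trans hl.2⟩)
  have h2 : P.root (P.reflectionPerm i l) = P.root l + (-P.pairingIn ℤ l i) • P.root i := by
    rw [RootPairing.root_reflectionPerm, RootPairing.reflection_apply_root' ℤ, neg_smul,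
      sub_eq_add_neg]
  rw [b.height_add_zsmul h2, RootPairing.Base.height_one_of_mem_support hi] at h1
  simp only [smul_eq_mul, mul_one] at h1
  lia

lemma pairingIn_eq_sum {k : ι} {f : ι → ℕ} (hf : P.root k = ∑ j ∈ b.support, f j • P.root j)
    (i : ι) : P.pairingIn ℤ k i = ∑ j ∈ b.support, f j * P.pairingIn ℤ j i := by
  apply FaithfulSMul.algebraMap_injective ℤ K
  rw [P.algebraMap_pairingIn, ← P.root_coroot'_eq_pairing, hf, map_sum, map_sum]
  refine Finset.sum_congr rfl fun j _ => ?_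
  rw [map_nsmul, P.root_coroot'_eq_pairing, map_mul, P.algebraMap_pairingIn]
  simp

section Irreducible

variable [P.IsReduced] [P.IsIrreducible]

/-- A vanishing coefficient next to a positive one would make the pairing with that simple coroot
negative, so positivity spreads along the connected Dynkin diagram. -/
lemma IsMaximalRoot.exists_full_support {k : ι} (hk : IsMaximalRoot b k) :
    ∃ f : ι → ℕ, P.root k = ∑ j ∈ b.support, f j • P.root j ∧ ∀ i ∈ b.support, 0 < f i := by
  obtain ⟨f, -, hf | hf⟩ := b.exists_root_eq_sum_nat_or_neg k
  · refine ⟨f, hf, fun i hi => ?_⟩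
    obtain ⟨i₀, hi₀, hpos⟩ : ∃ i₀ ∈ b.support, 0 < f i₀ := by
      by_contra! hcon
      refine P.ne_zero k ?_
      rw [hf]
      refine Finset.sum_eq_zero fun j hj => ?_
      rw [Nat.le_zero.mp (hcon j hj), zero_smul]
    refine b.induction_on_cartanMatrix (fun j => 0 < f j) (i := ⟨i₀, hi₀⟩) (j := ⟨i, hi⟩) hpos ?_
    intro i j hi hji
    by_contra hj
    have hj0 : f j = 0 := by lia
    have hij : i ≠ j := by rintro rfl; lia
    have hlt : P.pairingIn ℤ k j < 0 := by
      rw [pairingIn_eq_sum hf]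
      refine Finset.sum_neg' (fun l hl => ?_) ⟨i, i.2, ?_⟩
      · rcases eq_or_ne l j with rfl | hl'
        · rw [hj0]; simp
        · exact mul_nonpos_of_nonneg_of_nonpos (by positivity)
            (b.pairingIn_le_zero_of_ne hl' hl j.2)
      · have h1 := b.cartanMatrix_le_zero_of_ne i j hij
        have h2 : b.cartanMatrix i j ≠ 0 := by rwa [Ne, b.cartanMatrix_apply_eq_zero_iff_symm]
        exact mul_neg_of_pos_of_neg (by exact_mod_cast hi) (lt_of_le_of_ne h1 h2)
    exact (hk.pairingIn_nonneg j.2).not_gt hlt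
  · exfalso
    have h1 : P.root (P.reflectionPerm k k) ∈ AddSubmonoid.closure (P.root '' b.support) := by
      rw [root_reflectionPerm_self, hf, neg_neg]
      exact sum_mem fun j hj => nsmul_mem (AddSubmonoid.subset_closure (Set.mem_image_of_mem _ hj)) _
    rw [root_mem_closure_iff, isPos_of_root_eq_neg b (root_reflectionPerm_self k)] at h1
    exact h1 hk.isPos

lemma IsMaximalRoot.pairingIn_pos {k l : ι} (hk : IsMaximalRoot b k) (hl : IsMaximalRoot b l) :
    0 < P.pairingIn ℤ l k := by
  obtain ⟨f, hf, hpos⟩ := hk.exists_full_support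
  obtain ⟨i, hi, hil⟩ := hl.isPos.exists_mem_support_pos_pairingIn
  have h : P.pairingIn ℤ k l = ∑ j ∈ b.support, f j * P.pairingIn ℤ j l := pairingIn_eq_sum hf l
  rw [P.zero_lt_pairingIn_iff', h]
  refine Finset.sum_pos' (fun j hj => mul_nonneg (by positivity) ?_)
    ⟨i, hi, mul_pos (by exact_mod_cast hpos i hi) hil⟩
  by_contra! hneg
  rw [P.pairingIn_lt_zero_iff] at hneg
  exact (hl.pairingIn_nonneg hj).not_gt hneg

/-- Distinct maximal roots pair positively, so their difference is a root; whichever sign it has,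
one of the two could be raised. -/
lemma IsMaximalRoot.eq {k l : ι} (hk : IsMaximalRoot b k) (hl : IsMaximalRoot b l) : l = k := by
  by_contra hne
  obtain ⟨m, hm⟩ := P.root_sub_root_mem_of_pairingIn_pos (hk.pairingIn_pos hl) hne
  have h1 := b.height_sub hm
  by_cases hpos : b.IsPos m
  · have h2 := hk l (hm ▸ (root_mem_closure_iff b).mpr hpos)
    rw [RootPairing.Base.isPos_iff] at hpos
    lia
  · have h3 : b.IsPos (P.reflectionPerm m m) := by
      rwa [isPos_of_root_eq_neg b (root_reflectionPerm_self m)]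
    have h2 := hl k (by
      rw [← neg_sub, ← hm, ← root_reflectionPerm_self]
      exact (root_mem_closure_iff b).mpr h3)
    rw [RootPairing.Base.isPos_iff'] at hpos
    lia

variable (b) in
lemma exists_isHighestRoot [Nonempty ι] : ∃ k, IsHighestRoot b k := by
  obtain ⟨k, hk, -⟩ := exists_isMaximalRoot_ge b (Classical.arbitrary ι)
  refine ⟨k, fun i => ?_⟩
  obtain ⟨l, hl, hli⟩ := exists_isMaximalRoot_ge b i
  rwa [hk.eq hl] at hli

end Irreducible

lemma IsHighestRoot.isMaximalRoot {k : ι} (hk : IsHighestRoot b k) : IsMaximalRoot b k :=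
  fun l _ => height_le_of_sub_mem_closure b (hk l)

/-- Every root length is attained by a dominant root, and among dominant roots length increases with
the dominance order. -/
lemma IsHighestRoot.sqLength_le {k : ι} (hk : IsHighestRoot b k) (l : ι) :
    sqLength P l ≤ sqLength P k := by
  obtain ⟨m, hm, hml⟩ := exists_isDominantRoot_sqLength_eq b l
  rw [← hml]
  exact hm.sqLength_le (fun i hi => hk.isMaximalRoot.pairingIn_nonneg hi) (hk m)

/-- This is `⟨2ρ, α_i^∨⟩ = 2`: the reflection `s_i` permutes the other positive roots and negates
their pairings, so these cancel. -/
lemma sum_isPos_pairingIn_simple [P.IsReduced] {i : ι} (hi : i ∈ b.support) :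
    ∑ k ∈ Finset.univ.filter (fun k => b.IsPos k), P.pairingIn ℤ k i = 2 := by
  have hipos := RootPairing.Base.isPos_of_mem_support hi
  rw [← Finset.add_sum_erase _ _ (Finset.mem_filter.mpr ⟨Finset.mem_univ i, hipos⟩),
    P.pairingIn_same, add_eq_left]
  set s := (Finset.univ.filter fun k => b.IsPos k).erase i
  have hs : ∀ k ∈ s, P.reflectionPerm i k ∈ s := fun k hk => by
    simp only [s, Finset.mem_erase, Finset.mem_filter, Finset.mem_univ, true_and] at hk ⊢
    refine ⟨fun h => ?_, hk.2.reflectionPerm hi hk.1⟩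
    have h1 : k = P.reflectionPerm i i := by
      apply (P.reflectionPerm i).injective
      simpa using h
    exact not_isPos_reflectionPerm_self b hi (h1 ▸ hk.2)
  have hinv : ∀ k, P.reflectionPerm i (P.reflectionPerm i k) = k := fun k => by simp
  have h : ∑ k ∈ s, P.pairingIn ℤ k i = ∑ k ∈ s, - P.pairingIn ℤ k i := by
    refine Finset.sum_bij' (fun k _ => P.reflectionPerm i k) (fun k _ => P.reflectionPerm i k)
      hs hs (fun k _ => hinv k) (fun k _ => hinv k) fun k _ => ?_
    rw [← P.pairingIn_reflectionPerm_self_right ℤ, P.pairingIn_reflectionPerm]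
    simp
  rw [Finset.sum_neg_distrib] at h
  lia

/-- Pairing with `2ρ` and twice the coroot height are both linear and agree on the simple coroots.
-/
lemma sum_isPos_pairingIn [P.IsReduced] (i : ι) :
    ∑ k ∈ Finset.univ.filter (fun k => b.IsPos k), P.pairingIn ℤ k i = 2 * b.flip.height i := by
  have h : P.toLinearMap (∑ k ∈ Finset.univ.filter (fun k => b.IsPos k), P.root k) =
      (2 : K) • heightForm b.flip := by
    apply b.flip.toWeightBasis.ext
    rintro ⟨j, hj⟩
    have h2 := sum_isPos_pairingIn_simple (b := b) (i := j) hj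
    have h3 := heightForm_root b.flip j
    rw [RootPairing.Base.height_one_of_mem_support hj] at h3
    have h4 : b.flip.toWeightBasis ⟨j, hj⟩ = P.coroot j := by simp
    rw [h4, LinearMap.smul_apply]
    change _ = (2 : K) • heightForm b.flip (P.flip.root j)
    rw [h3, map_sum, LinearMap.sum_apply]
    simp only [P.root_coroot_eq_pairing, ← P.algebraMap_pairingIn ℤ]
    rw [← map_sum, h2]
    simp
  apply Int.cast_injective (α := K)
  have h5 := LinearMap.congr_fun h (P.coroot i)
  rw [LinearMap.smul_apply] at h5
  change _ = (2 : K) • heightForm b.flip (P.flip.root i) at h5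
  rw [heightForm_root, map_sum, LinearMap.sum_apply] at h5
  simp only [P.root_coroot_eq_pairing, ← P.algebraMap_pairingIn ℤ] at h5
  rw [← map_sum] at h5
  push_cast
  simpa using h5

lemma sum_univ_eq_two_mul_sum_isPos (b : P.Base) (f : ι → ℤ)
    (hf : ∀ k, f (P.reflectionPerm k k) = f k) :
    ∑ k, f k = 2 * ∑ k ∈ Finset.univ.filter (fun k => b.IsPos k), f k := by
  rw [← Finset.sum_filter_add_sum_filter_not Finset.univ (fun k => b.IsPos k), two_mul]
  congr 1
  have hinv : ∀ k, P.reflectionPerm (P.reflectionPerm k k) (P.reflectionPerm k k) = k := fun k =>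
    P.root.injective (by simp only [root_reflectionPerm_self, neg_neg])
  refine Finset.sum_bij' (fun k _ => P.reflectionPerm k k) (fun k _ => P.reflectionPerm k k)
    ?_ ?_ (fun k _ => hinv k) (fun k _ => hinv k) (fun k _ => (hf k).symm)
  · intro k hk
    rw [Finset.mem_filter] at hk ⊢
    exact ⟨Finset.mem_univ _,
      (isPos_of_root_eq_neg b (root_reflectionPerm_self k)).mpr hk.2⟩
  · intro k hk
    rw [Finset.mem_filter] at hk ⊢
    refine ⟨Finset.mem_univ _, ?_⟩
    rw [isPos_of_root_eq_neg b (root_reflectionPerm_self k), not_not]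
    exact hk.2

/-- As `θ` is dominant and longest, `⟨β, θ^∨⟩ ∈ {0, 1}` for positive `β ≠ θ`, so squaring changes
only the term of `θ` itself, from `2` to `4`. The sum over positive roots is thus `2 + ⟨2ρ, θ^∨⟩`,
and the negative roots double it. -/
lemma IsHighestRoot.sum_pairingIn_sq [P.IsReduced] {i : ι} (hi : IsHighestRoot b i) :
    ∑ k, P.pairingIn ℤ k i ^ 2 = 4 * (1 + b.flip.height i) := by
  have hipos := hi.isMaximalRoot.isPos
  have hdom : ∀ k, b.IsPos k → 0 ≤ P.pairingIn ℤ k i := fun k hk => by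
    obtain ⟨n, hn⟩ := hi.isMaximalRoot.isDominantRoot.two_mul_form_eq_natCast
      ((root_mem_closure_iff b).mpr hk)
    have h2 := (P.posRootForm ℤ).two_mul_apply_root_root k i
    have h3 := (P.posRootForm ℤ).symm.eq (P.root k) (P.root i)
    rw [RingHom.id_apply] at h3
    rw [h3, hn, ← sqLength_cast, ← P.algebraMap_pairingIn ℤ] at h2
    have h4 : (n : ℤ) = P.pairingIn ℤ k i * sqLength P i := by
      apply Int.cast_injective (α := K)
      push_cast
      exact h2
    have h5 := sqLength_pos (P := P) i
    by_contra! hneg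
    have := mul_neg_of_neg_of_pos hneg h5
    lia
  rw [sum_univ_eq_two_mul_sum_isPos b _ (fun k => by simp)]
  have hmem := Finset.mem_filter.mpr ⟨Finset.mem_univ i, hipos⟩
  have h1 : ∑ k ∈ Finset.univ.filter (fun k => b.IsPos k), P.pairingIn ℤ k i ^ 2 =
      2 + ∑ k ∈ Finset.univ.filter (fun k => b.IsPos k), P.pairingIn ℤ k i := by
    rw [← Finset.add_sum_erase _ _ hmem, ← Finset.add_sum_erase _ _ hmem, P.pairingIn_same]
    have : ∑ k ∈ (Finset.univ.filter fun k => b.IsPos k).erase i, P.pairingIn ℤ k i ^ 2 =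
        ∑ k ∈ (Finset.univ.filter fun k => b.IsPos k).erase i, P.pairingIn ℤ k i := by
      refine Finset.sum_congr rfl fun k hk => ?_
      simp only [Finset.mem_erase, Finset.mem_filter, Finset.mem_univ, true_and] at hk
      have h2 : P.pairingIn ℤ k i ∈ ({-1, 0, 1} : Set ℤ) := by
        by_contra hcon
        have h3 := RootPairing.RootPositiveForm.rootLength_lt_of_pairingIn_notMem
          (P.posRootForm ℤ) (fun e => hk.1 (P.root.injective e))
          (fun e => (isPos_of_root_eq_neg b e).mp hk.2 hipos) hcon
        exact (hi.sqLength_le k).not_gt h3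
      have h4 := hdom k hk.2
      simp only [Set.mem_insert_iff, Set.mem_singleton_iff] at h2
      rcases h2 with h2 | h2 | h2 <;> rw [h2] at h4 ⊢ <;> lia
    rw [this]
    ring
  rw [h1, sum_isPos_pairingIn]
  ring

/-- The squared lengths of the roots, normalized to be `1` on short roots, add up to the rank times
`r h^∨`. -/
theorem sum_symmetrizerNat [P.IsReduced] [P.IsIrreducible] [Nonempty ι] (b : P.Base) :
    ((∑ k, symmetrizerNat P k : ℕ) : ℤ) = Fintype.card b.support * rTimesDualCoxeter b := by
  have hex := exists_isHighestRoot b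
  set i := hex.choose with hi_def
  have hi : IsHighestRoot b i := hex.choose_spec
  have hdual : dualCoxeterNumber b = 1 + b.flip.height i := by
    rw [dualCoxeterNumber, dif_pos hex]
  have hm := sInf_sqLength_pos (P := P)
  -- The highest root is a longest root, so the supremum defining `r` is attained there.
  have hlacing : lacingNumber P = symmetrizer P i := by
    refine IsGreatest.csSup_eq ⟨⟨i, rfl⟩, ?_⟩
    rintro _ ⟨k, rfl⟩
    have h := hi.sqLength_le k
    rw [(symmetrizer_spec (P := P) k).1, (symmetrizer_spec (P := P) i).1] at h
    exact le_of_mul_le_mul_right h hm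
  have h := four_mul_sum_sqLength b i
  rw [hi.sum_pairingIn_sq] at h
  rw [rTimesDualCoxeter, hlacing, hdual]
  push_cast
  simp only [symmetrizerNat_cast]
  have h2 : ∑ k, sqLength P k = (∑ k, symmetrizer P k) * sInf (Set.range (sqLength P)) := by
    rw [Finset.sum_mul]
    exact Finset.sum_congr rfl fun k _ => (symmetrizer_spec (P := P) k).1
  rw [h2, (symmetrizer_spec (P := P) i).1] at h
  apply mul_right_cancel₀ (mul_ne_zero four_ne_zero hm.ne')
  linear_combination h

end Highest

end

end QuantumCartan

namespace QuantumCartan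

noncomputable section

/-! ### Coefficients of a quasi-periodic expansion -/

section Coefficients

/-- The relations between the coefficients `c i j u` of the expansion of `W / (1 + z^n σ)` and the
coefficients of a palindromic numerator `W`, from which the symmetries of `c` follow. -/
structure IsQuasiPeriodic {I : Type*} (σ : I → I) (d : I → ℤ) (n : ℤ) (c W : I → I → ℤ → ℚ) :
    Prop where
  involutive : ∀ j, σ (σ j) = j
  one_le : ∀ i, 1 ≤ d i
  pos : 0 < n
  eq_add : ∀ i j u, W i j u = c i j u + c i (σ j) (u - n)
  palindromic : ∀ i j u, W i j u = W i (σ j) (n - u)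
  nonneg : ∀ i j u, 0 ≤ W i j u
  eq_zero : ∀ i j u, u < d i → c i j u = 0
  lead : ∀ i j, c i j (d i) = (kroneckerDelta i j : ℤ)

namespace IsQuasiPeriodic

variable {I : Type*} {σ : I → I} {d : I → ℤ} {n : ℤ} {c W : I → I → ℤ → ℚ}


lemma eq_zero_of_nonpos (h : IsQuasiPeriodic σ d n c W)
    (i j : I) {u : ℤ} (hu : u ≤ 0) : c i j u = 0 :=
  h.eq_zero i j u (by have := h.one_le i; omega)

/-- By palindromicity the numerator at `u + n` equals a numerator coefficient at `-u ≤ 0`, which is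
zero; the two terms of `eq_add` therefore cancel. -/
lemma shift (h : IsQuasiPeriodic σ d n c W)
    (i j : I) {u : ℤ} (hu : 0 ≤ u) : c i j (u + n) = -c i (σ j) u := by
  have h1 := h.eq_add i j (u + n)
  have h2 := h.eq_add i (σ j) (n - (u + n))
  rw [← h.palindromic, h.eq_zero_of_nonpos i _ (by omega),
    h.eq_zero_of_nonpos i _ (by have := h.pos; omega)] at h2
  rw [h2, add_sub_cancel_right] at h1
  linarith

/-- Up to degree `n` the correction term in `eq_add` vanishes, so `c` coincides with the palindromic
numerator. -/
lemma reflect (h : IsQuasiPeriodic σ d n c W)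
    (i j : I) {u : ℤ} (hu : 0 ≤ u) (hun : u ≤ n) : c i j (n - u) = c i (σ j) u := by
  have h1 := h.eq_add i j (n - u)
  have h2 := h.eq_add i (σ j) u
  rw [h.palindromic, h.involutive, h.eq_zero_of_nonpos i _ (by omega : u - n ≤ 0)] at h2
  rw [h.eq_zero_of_nonpos i _ (by omega : n - u - n ≤ 0)] at h1
  linarith

lemma shift_two (h : IsQuasiPeriodic σ d n c W)
    (i j : I) {u : ℤ} (hu : 0 ≤ u) : c i j (u + 2 * n) = c i j u := by
  have := h.pos
  rw [show u + 2 * n = (u + n) + n by ring, h.shift i j (by omega), h.shift i _ hu, h.involutive,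
    neg_neg]

lemma reflect_two (h : IsQuasiPeriodic σ d n c W) (i j : I) {u : ℤ} (hu : 0 ≤ u) (hun : u ≤ 2 * n) :
    c i j (2 * n - u) = -c i j u := by
  rcases le_total u n with hu' | hu'
  · rw [show 2 * n - u = (n - u) + n by ring, h.shift i j (by omega), h.reflect i _ hu hu',
      h.involutive]
  · obtain ⟨v, rfl⟩ : ∃ v, u = v + n := ⟨u - n, by ring⟩
    rw [show 2 * n - (v + n) = n - v by ring, h.reflect i j (by omega) (by omega),
      h.shift i j (by omega), neg_neg]

lemma shift_iterate (h : IsQuasiPeriodic σ d n c W) (i j : I) (k : ℕ) {u : ℤ} (hu : 0 ≤ u) :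
    c i j (u + k * n) = (-1) ^ k * c i (σ^[k] j) u := by
  have := h.pos
  induction k generalizing j with
  | zero => simp
  | succ k ih =>
    rw [show u + (k + 1 : ℕ) * n = (u + k * n) + n by push_cast; ring,
      h.shift i j (by positivity), ih, Function.iterate_succ_apply]
    ring

lemma eq_zero_of_le (h : IsQuasiPeriodic σ d n c W)
    (i j : I) {u : ℤ} (hu : u ≤ d i - kroneckerDelta i j) : c i j u = 0 := by
  by_cases hij : i = j
  · simp only [kroneckerDelta, hij, if_true] at hu
    exact h.eq_zero i j u (by subst hij; omega)
  · have hu : u ≤ d i := by simpa [kroneckerDelta, hij] using hu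
    rcases lt_or_eq_of_le hu with hu' | hu'
    · exact h.eq_zero i j u hu'
    · rw [hu', h.lead]
      simp [kroneckerDelta, hij]

/-- If `d_i > n`, the leading coefficient `1` would equal its mirror image in the negative degree `n
- d_i`, which is zero. -/
lemma le_period (h : IsQuasiPeriodic σ d n c W) (i : I) : d i ≤ n := by
  by_contra! hn
  have h0 := h.one_le i
  have h1 := h.eq_add i i (d i)
  have h2 := h.eq_add i (σ i) (n - d i)
  have := h.pos
  rw [h.palindromic, h2, h.involutive, h.lead, h.eq_zero i (σ i) (n - d i) (by omega),
    h.eq_zero i i _ (by omega), h.eq_zero i (σ i) (d i - n) (by omega)] at h1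
  simp [kroneckerDelta] at h1

lemma vanishing (h : IsQuasiPeriodic σ d n c W) (i j : I) {u : ℤ} (k : ℕ)
    (hu : |u - k * n| ≤ d i - kroneckerDelta i (σ^[k] j)) : c i j u = 0 := by
  rw [abs_le] at hu
  rcases le_total (k * n) u with hk | hk
  · obtain ⟨v, rfl⟩ : ∃ v, u = v + k * n := ⟨u - k * n, by ring⟩
    rw [h.shift_iterate i j k (by omega), h.eq_zero_of_le i _ (by omega), mul_zero]
  · cases k with
    | zero => exact h.eq_zero_of_nonpos i j (by simpa using hk)
    | succ k =>
      -- Approaching the multiple `(k + 1) n` from below, `v` is the distance to it; `k` shifts and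
      -- one reflection bring the coefficient to degree `v`, applying `σ` in total `k + 1` times.
      obtain ⟨v, rfl⟩ : ∃ v, u = (n - v) + k * n := ⟨n + k * n - u, by ring⟩
      have hδ : 0 ≤ kroneckerDelta i (σ^[k + 1] j) := by
        unfold kroneckerDelta; split_ifs <;> simp
      have h1 := h.le_period i
      push_cast at hu hk
      have hv : v ≤ d i - kroneckerDelta i (σ^[k + 1] j) := by linarith [hu.1]
      have hv0 : 0 ≤ v := by linarith
      rw [h.shift_iterate i j k (by linarith), h.reflect i _ hv0 (by linarith),
        ← Function.iterate_succ_apply' σ, h.eq_zero_of_le i _ hv, mul_zero]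

lemma coeff_nonneg (h : IsQuasiPeriodic σ d n c W)
    (i j : I) {u : ℤ} (hu : u ≤ n) : 0 ≤ c i j u := by
  have h1 := h.eq_add i j u
  rw [h.eq_zero_of_nonpos i _ (by omega : u - n ≤ 0), add_zero] at h1
  exact h1 ▸ h.nonneg i j u

lemma coeff_nonpos (h : IsQuasiPeriodic σ d n c W)
    (i j : I) {u : ℤ} (hu : n ≤ u) (hu' : u ≤ 2 * n) : c i j u ≤ 0 := by
  obtain ⟨v, rfl⟩ : ∃ v, u = v + n := ⟨u - n, by ring⟩
  rw [h.shift i j (by omega)]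
  simpa using h.coeff_nonneg i (σ j) (by omega : v ≤ n)

end IsQuasiPeriodic

end Coefficients

end

end QuantumCartan

namespace QuantumCartan

noncomputable section

open scoped Classical

variable {ι K M N : Type*} [Fintype ι] [Field K] [CharZero K] [AddCommGroup M] [Module K M]
  [AddCommGroup N] [Module K N] {P : RootPairing ι K M N} [P.IsCrystallographic]

/-! ### The quantum Cartan matrix and its deformation -/

section Expansion

/-- The inclusion of `ℤ[X]` into the field of rational functions. -/
def toRatFunc : Polynomial ℤ →+* RatFunc ℚ :=
  (algebraMap (Polynomial ℚ) (RatFunc ℚ)).comp (Polynomial.mapRingHom (Int.castRingHom ℚ))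

lemma toRatFunc_X : toRatFunc Polynomial.X = RatFunc.X := by simp [toRatFunc]

/-- The inclusion of `ℤ⟦X⟧` into the ring of Laurent series. -/
def toLaurentSeries : PowerSeries ℤ →+* ℚ⸨X⸩ :=
  (HahnSeries.ofPowerSeries ℤ ℚ).comp (PowerSeries.map (Int.castRingHom ℚ))

lemma toLaurentSeries_X : toLaurentSeries PowerSeries.X = HahnSeries.single 1 1 := by
  simp [toLaurentSeries]

lemma coeff_toLaurentSeries (f : PowerSeries ℤ) (u : ℤ) :
    (toLaurentSeries f).coeff u = ((if u < 0 then 0 else f.coeff u.natAbs : ℤ) : ℚ) := by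
  rw [toLaurentSeries, RingHom.comp_apply]
  have := PowerSeries.coeff_coe (PowerSeries.map (Int.castRingHom ℚ) f) u
  rw [this]
  split_ifs <;> simp

/-- The Laurent expansion at `0` of a rational function. -/
def expand (F : Type*) [Field F] : RatFunc F →+* F⸨X⸩ := letI := RatFunc.liftAlgebra F F⸨X⸩; algebraMap (RatFunc F) F⸨X⸩

lemma expand_X (F : Type*) [Field F] : expand F RatFunc.X = HahnSeries.single 1 1 :=
  RatFunc.coe_X

lemma expand_toRatFunc (p : Polynomial ℤ) :
    expand ℚ (toRatFunc p) = toLaurentSeries (p : PowerSeries ℤ) := by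
  have : (expand ℚ).comp toRatFunc =
      toLaurentSeries.comp Polynomial.coeToPowerSeries.ringHom := by
    apply Polynomial.ringHom_ext'
    · exact RingHom.ext_int _ _
    · simp [toRatFunc_X, toLaurentSeries_X, expand_X]
  exact congr($this p)

/-- A geometric sum for the quantum integer `[-a]`; the lowest exponent after multiplication by
`x^e` is `f = e + 1 - a`. -/
lemma div_mul_zpow_eq {F : Type*} [Field F] {x : F} (h0 : x ≠ 0) (h1 : x ^ 2 ≠ 1) {a e f : ℕ}
    (h : e + 1 = a + f) :
    (x ^ (-a : ℤ) - x ^ (a : ℤ)) / (x - x⁻¹) * x ^ e =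
      -∑ k ∈ Finset.range a, x ^ (f + 2 * k) := by
  have h2 : x - x⁻¹ ≠ 0 := fun h => h1 <| by field_simp at h; linear_combination h
  have h3 : ∑ k ∈ Finset.range a, x ^ (f + 2 * k) = x ^ f * ((x ^ (2 * a) - 1) / (x ^ 2 - 1)) := by
    rw [pow_mul, ← geom_sum_eq h1, Finset.mul_sum]
    exact Finset.sum_congr rfl fun k _ => by rw [pow_add, pow_mul]
  have h4 : x ^ e * x = x ^ a * x ^ f := by rw [← pow_succ, h, pow_add]
  have h5 : x ^ 2 - 1 ≠ 0 := sub_ne_zero.mpr h1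
  rw [h3, zpow_neg, zpow_natCast]
  have h6 : x - x⁻¹ = (x ^ 2 - 1) / x := by field_simp
  have h7 : x ^ e = x ^ a * x ^ f / x := by rw [← h4]; field_simp
  rw [h6, h7]
  field_simp
  ring

lemma RatFunc_X_sq_ne_one : (RatFunc.X : RatFunc ℚ) ^ 2 ≠ 1 := by
  rw [← RatFunc.algebraMap_X, ← map_pow, ← map_one (algebraMap (Polynomial ℚ) (RatFunc ℚ))]
  intro h
  have := congr(Polynomial.eval 0 $(RatFunc.algebraMap_injective ℚ h))
  simp at this

variable [P.IsReduced] [P.IsIrreducible] (b : P.Base)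

/-- This makes the truncated subtraction in the exponents of `deformedCartan` exact and those
exponents positive, so that the off-diagonal entries vanish at `X = 0`. -/
lemma cartanNat_le {i j : b.support} (h : i ≠ j) : cartanNat b i j ≤ symmetrizerNat P j := by
  have := symmetrizerNat_pos (P := P) j
  have := rank_two_cases b h
  omega

lemma quantumCartan_mul_X_pow (i j : b.support) :
    quantumCartan b i j * RatFunc.X ^ symmetrizerNat P j = toRatFunc (deformedCartan b i j) := by
  have hX : (RatFunc.X : RatFunc ℚ) ≠ 0 := RatFunc.X_ne_zero
  rcases eq_or_ne i j with rfl | h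
  · rw [deformedCartan_self, quantumCartan, Matrix.of_apply, if_pos rfl, ← symmetrizerNat_cast,
      zpow_neg, zpow_natCast, add_mul, inv_mul_cancel₀ (pow_ne_zero _ hX)]
    simp only [map_add, map_one, map_pow, toRatFunc_X]
    ring
  · have hle := cartanNat_le b h
    rw [deformedCartan_of_ne b h, quantumCartan, Matrix.of_apply, if_neg h, qInt,
      cartanEntry_of_ne b h, neg_neg,
      div_mul_zpow_eq hX RatFunc_X_sq_ne_one
        (f := symmetrizerNat P j + 1 - cartanNat b i j) (by omega)]
    simp only [map_neg, map_sum, map_pow, toRatFunc_X]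
    congr 1
    exact Finset.sum_congr rfl fun k _ => by congr 1; omega

lemma deformedCartan_eval_zero (i j : b.support) :
    (deformedCartan b i j).eval 0 = (1 : Matrix b.support b.support ℤ) i j := by
  rcases eq_or_ne i j with rfl | h
  · have := symmetrizerNat_pos (P := P) i
    rw [deformedCartan_self]
    simp [this.ne']
  · have hle := cartanNat_le b h
    rw [deformedCartan_of_ne b h, Matrix.one_apply_ne h]
    simp only [Polynomial.eval_neg, Polynomial.eval_finsetSum, Polynomial.eval_pow,
      Polynomial.eval_X, neg_eq_zero]
    exact Finset.sum_eq_zero fun k _ => zero_pow (by omega)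

/-! ### Inversion over integer power series -/

/-- The deformed Cartan matrix over the ring of power series. -/
def seriesCartan : Matrix b.support b.support (PowerSeries ℤ) :=
  (deformedCartan b).map Polynomial.coeToPowerSeries.ringHom

/-- The constant term of the matrix is the identity. Inverting already over `ℤ⟦X⟧` is what makes the
coefficients integers. -/
lemma isUnit_det_seriesCartan : IsUnit (seriesCartan b).det := by
  rw [PowerSeries.isUnit_iff_constantCoeff, RingHom.map_det]
  have : (PowerSeries.constantCoeff (R := ℤ)).mapMatrix (seriesCartan b) = 1 := by
    ext i j
    rw [← deformedCartan_eval_zero b i j, ← Polynomial.coeff_zero_eq_eval_zero]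
    simp [seriesCartan]
  rw [this]
  simp

/-- The inverse of the deformed Cartan matrix over the ring of power series. -/
def seriesInv : Matrix b.support b.support (PowerSeries ℤ) := (seriesCartan b)⁻¹

lemma seriesCartan_mul_inv : seriesCartan b * seriesInv b = 1 :=
  Matrix.mul_nonsing_inv _ (isUnit_det_seriesCartan b)

lemma constantCoeff_seriesInv (i j : b.support) :
    PowerSeries.constantCoeff (seriesInv b i j) = (1 : Matrix b.support b.support ℤ) i j := by
  have h := congr((PowerSeries.constantCoeff (R := ℤ)).mapMatrix $(seriesCartan_mul_inv b))
  have : (PowerSeries.constantCoeff (R := ℤ)).mapMatrix (seriesCartan b) = 1 := by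
    ext i j
    rw [← deformedCartan_eval_zero b i j, ← Polynomial.coeff_zero_eq_eval_zero]
    simp [seriesCartan]
  rw [map_mul, this, one_mul, map_one] at h
  exact congr($h i j)

/-! ### Comparison with the inverse over rational functions -/

lemma quantumCartan_mul_diagonal :
    quantumCartan b * Matrix.diagonal (fun j : b.support => RatFunc.X ^ symmetrizerNat P j) =
      (deformedCartan b).map toRatFunc := by
  ext i j
  rw [Matrix.mul_diagonal, quantumCartan_mul_X_pow, Matrix.map_apply]

/-- From `C D = A` the inverse of `C` is `D A⁻¹`. Producing it over Laurent series both shows that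
`C` is invertible over `ℚ(z)` and identifies its expansion. -/
lemma laurent_mul_eq_one :
    (quantumCartan b).map (expand ℚ) *
      (Matrix.of fun i j : b.support =>
        toLaurentSeries (PowerSeries.X ^ symmetrizerNat P i * seriesInv b i j)) = 1 := by
  have h1 := congr((expand ℚ).mapMatrix $(quantumCartan_mul_diagonal b))
  have h2 := congr(toLaurentSeries.mapMatrix $(seriesCartan_mul_inv b))
  rw [map_mul, map_one] at h2
  have h3 : toLaurentSeries.mapMatrix (seriesCartan b) =
      (expand ℚ).mapMatrix ((deformedCartan b).map toRatFunc) := by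
    ext1 i j
    exact (expand_toRatFunc _).symm
  rw [h3, ← h1, map_mul, mul_assoc] at h2
  rw [← h2]
  congr 1
  ext1 i j
  rw [RingHom.mapMatrix_apply, Matrix.diagonal_map (map_zero _), Matrix.diagonal_mul]
  simp [toLaurentSeries_X, expand_X]

lemma isUnit_det_quantumCartan : IsUnit (quantumCartan b).det := by
  have h := congr(Matrix.det $(laurent_mul_eq_one b))
  rw [Matrix.det_mul, Matrix.det_one] at h
  rw [isUnit_iff_ne_zero]
  intro h0
  have h1 := RingHom.map_det (expand ℚ) (quantumCartan b)
  rw [h0, map_zero] at h1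
  rw [RingHom.mapMatrix_apply] at h1
  rw [← h1, zero_mul] at h
  exact zero_ne_one h

theorem quantumCartan_mul_inv : quantumCartan b * invQuantumCartan b = 1 :=
  Matrix.mul_nonsing_inv _ (isUnit_det_quantumCartan b)

lemma quantumCartan_mul_inv_apply (i j : b.support) :
    (quantumCartan b * invQuantumCartan b) i j = (kroneckerDelta i j : RatFunc ℚ) := by
  rw [quantumCartan_mul_inv, Matrix.one_apply, kroneckerDelta]
  split_ifs <;> simp

lemma expand_invQuantumCartan (i j : b.support) :
    expand ℚ (invQuantumCartan b i j) =
      toLaurentSeries (PowerSeries.X ^ symmetrizerNat P i * seriesInv b i j) := by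
  have h := congr((expand ℚ).mapMatrix $(quantumCartan_mul_inv b))
  rw [map_mul, map_one, RingHom.mapMatrix_apply] at h
  have h1 := mul_eq_one_comm.mp h
  have h2 := left_inv_eq_right_inv h1 (laurent_mul_eq_one b)
  exact congr($h2 i j)

lemma invCoeff_eq (i j : b.support) (u : ℤ) :
    invCoeff b i j u = ((if u < 0 then 0 else
      (PowerSeries.X ^ symmetrizerNat P i * seriesInv b i j).coeff u.natAbs : ℤ) : ℚ) := by
  rw [← coeff_toLaurentSeries, ← expand_invQuantumCartan]
  rfl

lemma invCoeff_of_lt (i j : b.support) {u : ℤ} (h : u < symmetrizerNat P i) :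
    invCoeff b i j u = 0 := by
  rw [invCoeff_eq]
  split_ifs with h'
  · simp
  · rw [PowerSeries.coeff_X_pow_mul', if_neg (by omega), Int.cast_zero]

/-- `A⁻¹` has constant term `1`, and row `i` is shifted by `z^{d_i}`. -/
lemma invCoeff_symmetrizerNat (i j : b.support) :
    invCoeff b i j (symmetrizerNat P i) = (kroneckerDelta i j : ℤ) := by
  rw [invCoeff_eq, if_neg (by omega), PowerSeries.coeff_X_pow_mul', if_pos (by omega)]
  have := constantCoeff_seriesInv b i j
  rw [← PowerSeries.coeff_zero_eq_constantCoeff_apply] at this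
  simp [this, kroneckerDelta, Matrix.one_apply]

end Expansion

end

end QuantumCartan

namespace QuantumCartan

noncomputable section

open scoped Classical

variable {ι K M N : Type*} [Fintype ι] [Field K] [CharZero K] [AddCommGroup M] [Module K M]
  [AddCommGroup N] [Module K N] {P : RootPairing ι K M N} [P.IsCrystallographic]

/-! ### The numerator of the expansion -/

section Numerator

open Polynomial in
lemma coeff_toLaurent_eq (p : ℤ[X]) (u : ℤ) :
    (toLaurent p).coeff u = if u < 0 then 0 else p.coeff u.natAbs := by
  induction p using Polynomial.induction_on' with
  | add p q hp hq =>
    simp only [map_add, AddMonoidAlgebra.coeff_add, Finsupp.add_apply, hp, hq, coeff_add]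
    split_ifs <;> simp
  | monomial n a =>
    rw [← C_mul_X_pow_eq_monomial, toLaurent_C_mul_X_pow, ← LaurentPolynomial.single_eq_C_mul_T,
      coeff_C_mul_X_pow]
    simp only [AddMonoidAlgebra.coeff_single, Finsupp.single_apply]
    split_ifs <;> first | rfl | omega

lemma coeff_toLaurentSeries_X_pow_mul (f : PowerSeries ℤ) (n : ℕ) (u : ℤ) :
    (toLaurentSeries (PowerSeries.X ^ n * f)).coeff u = (toLaurentSeries f).coeff (u - n) := by
  rw [coeff_toLaurentSeries, coeff_toLaurentSeries, PowerSeries.coeff_X_pow_mul']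
  congr 1
  split_ifs <;> first | rfl | omega | (congr 1; congr 1; omega)

variable [P.IsReduced] [P.IsIrreducible] (b : P.Base)

lemma invCoeff_eq_coeff (i j : b.support) (u : ℤ) :
    invCoeff b i j u =
      (toLaurentSeries (PowerSeries.X ^ symmetrizerNat P i * seriesInv b i j)).coeff u := by
  rw [invCoeff_eq, coeff_toLaurentSeries]

variable {b} {n : ℕ} {Q : Matrix b.support b.support (Polynomial ℤ)}

/-- The coefficients of the numerator `diag(z^{d_i}) Q`. -/
def numCoeff (Q : Matrix b.support b.support (Polynomial ℤ)) (i j : b.support) (u : ℤ) : ℚ :=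
  ((Polynomial.toLaurent (Polynomial.X ^ symmetrizerNat P i * Q i j)).coeff u : ℤ)

lemma numCoeff_nonneg (hQ : ∀ i j, NonnegCoeff (Q i j)) (i j : b.support) (u : ℤ) :
    0 ≤ numCoeff Q i j u := by
  rw [numCoeff, coeff_toLaurent_eq, Int.cast_nonneg_iff]
  split_ifs
  · exact le_rfl
  · rw [Polynomial.coeff_X_pow_mul']
    split_ifs
    · exact hQ i j _
    · exact le_rfl

lemma numCoeff_eq_coeff (i j : b.support) (u : ℤ) :
    numCoeff Q i j u =
      (toLaurentSeries (PowerSeries.X ^ symmetrizerNat P i * (Q i j : PowerSeries ℤ))).coeff u := by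
  rw [numCoeff, coeff_toLaurent_eq, coeff_toLaurentSeries, ← Polynomial.coe_X,
    ← Polynomial.coe_pow, ← Polynomial.coe_mul, Polynomial.coeff_coe]

variable [P.IsRootSystem]

lemma mul_starMatrix_apply {R : Type*} [CommRing R] (A : Matrix b.support b.support R)
    (i j : b.support) : (A * starMatrix b R) i j = A i (starInvolution b j) := by
  simp [Matrix.mul_apply, starMatrix]

lemma starMatrix_mul_apply {R : Type*} [CommRing R] (A : Matrix b.support b.support R)
    (i j : b.support) : (starMatrix b R * A) i j = A (starInvolution b i) j := by
  have : ∀ k, i = starInvolution b k ↔ starInvolution b i = k :=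
    fun k => ⟨fun h => by rw [h, starInvolution_starInvolution],
      fun h => by rw [← h, starInvolution_starInvolution]⟩
  simp [Matrix.mul_apply, starMatrix, this]

lemma starMatrix_mul_self (R : Type*) [CommRing R] : starMatrix b R * starMatrix b R = 1 := by
  ext i j
  rw [mul_starMatrix_apply, starMatrix, Matrix.of_apply, starInvolution_starInvolution,
    Matrix.one_apply]

lemma starMatrix_map {R S : Type*} [CommRing R] [CommRing S] (f : R →+* S) :
    f.mapMatrix (starMatrix b R) = starMatrix b S := by
  ext i j
  simp only [starMatrix, RingHom.mapMatrix_apply, Matrix.map_apply, Matrix.of_apply]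
  split_ifs <;> simp

lemma commute_starMatrix :
    deformedCartan b * starMatrix b _ = starMatrix b _ * deformedCartan b := by
  ext1 i j
  rw [mul_starMatrix_apply, starMatrix_mul_apply, ← deformedCartan_starInvolution,
    starInvolution_starInvolution]

lemma coe_map_smul_starMatrix {R : Type*} [CommRing R] (f : Polynomial ℤ →+* R) :
    f.mapMatrix (1 + (Polynomial.X ^ n : Polynomial ℤ) • starMatrix b _) =
      1 + f Polynomial.X ^ n • starMatrix b R := by
  rw [map_add, map_one, ← starMatrix_map f]
  congr 1
  ext1 i j
  simp

lemma seriesCartan_mul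
    (h : Q * deformedCartan b = 1 + (Polynomial.X ^ n : Polynomial ℤ) • starMatrix b _) :
    seriesCartan b * Polynomial.coeToPowerSeries.ringHom.mapMatrix Q =
      Polynomial.coeToPowerSeries.ringHom.mapMatrix
        (1 + (Polynomial.X ^ n : Polynomial ℤ) • starMatrix b _) := by
  have h1 : deformedCartan b * Q * deformedCartan b =
      (1 + (Polynomial.X ^ n : Polynomial ℤ) • starMatrix b _) * deformedCartan b := by
    rw [mul_assoc, h, mul_add, add_mul, mul_one, one_mul, Matrix.mul_smul, Matrix.smul_mul,
      commute_starMatrix]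
  have h2 := congrArg (Polynomial.coeToPowerSeries.ringHom.mapMatrix · * seriesInv b) h1
  simp only [map_mul] at h2
  change seriesCartan b * _ * seriesCartan b * _ = _ * seriesCartan b * _ at h2
  rwa [mul_assoc, seriesCartan_mul_inv, mul_one, mul_assoc, seriesCartan_mul_inv, mul_one] at h2

/-- `σ` commutes with `A`, so the relation `Q A = 1 + X^n σ` also holds with the factors exchanged;
the cancellation of `A` takes place over power series. -/
lemma deformedCartan_mul
    (h : Q * deformedCartan b = 1 + (Polynomial.X ^ n : Polynomial ℤ) • starMatrix b _) :
    deformedCartan b * Q = 1 + (Polynomial.X ^ n : Polynomial ℤ) • starMatrix b _ := by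
  have h1 := seriesCartan_mul h
  change Polynomial.coeToPowerSeries.ringHom.mapMatrix _ * _ = _ at h1
  rw [← map_mul] at h1
  exact Matrix.map_injective (Polynomial.coe_injective ℤ) h1

/-- This is `D Q = C⁻¹ (1 + z^n σ)` coefficient by coefficient; multiplying by `σ` on the right
permutes the columns. -/
lemma numCoeff_eq_add
    (h : Q * deformedCartan b = 1 + (Polynomial.X ^ n : Polynomial ℤ) • starMatrix b _)
    (i j : b.support) (u : ℤ) :
    numCoeff Q i j u = invCoeff b i j u + invCoeff b i (starInvolution b j) (u - n) := by
  have h1 : seriesInv b * seriesCartan b = 1 := mul_eq_one_comm.mp (seriesCartan_mul_inv b)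
  have h2 := congr(seriesInv b * $(seriesCartan_mul h))
  rw [← mul_assoc, h1, one_mul, coe_map_smul_starMatrix, mul_add, mul_one, Matrix.mul_smul] at h2
  have h3 := congr($h2 i j)
  rw [Matrix.add_apply, Matrix.smul_apply, mul_starMatrix_apply] at h3
  simp only [RingHom.mapMatrix_apply, Matrix.map_apply, Polynomial.coeToPowerSeries.ringHom_apply,
    Polynomial.coe_X, smul_eq_mul] at h3
  rw [numCoeff_eq_coeff, h3, invCoeff_eq_coeff, invCoeff_eq_coeff, mul_add, map_add,
    HahnSeries.coeff_add, ← coeff_toLaurentSeries_X_pow_mul, mul_left_comm]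

/-! ### Palindromicity of the numerator -/

open LaurentPolynomial in
/-- The quantum Cartan matrix over the ring of Laurent polynomials. -/
def laurentCartan (b : P.Base) : Matrix b.support b.support ℤ[T;T⁻¹] :=
  Polynomial.toLaurent.mapMatrix (deformedCartan b) *
    Matrix.diagonal fun j : b.support => T (-symmetrizerNat P j)

open LaurentPolynomial in
-- `C(z) = C(z⁻¹)`: inversion swaps the two terms on the diagonal and reverses the sum forming a
-- quantum integer.
lemma invert_laurentCartan (i j : b.support) :
    invert (laurentCartan b i j) = laurentCartan b i j := by
  rw [laurentCartan, Matrix.mul_diagonal, RingHom.mapMatrix_apply, Matrix.map_apply]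
  rcases eq_or_ne i j with rfl | h
  · rw [deformedCartan_self]
    simp only [map_add, map_one, Polynomial.toLaurent_X_pow, add_mul, one_mul, ← T_add, invert_T]
    rw [add_comm]
    congr 2 <;> push_cast <;> ring
  · have hle := cartanNat_le b h
    rw [deformedCartan_of_ne b h]
    simp only [map_neg, map_sum, Polynomial.toLaurent_X_pow, neg_mul, Finset.sum_mul, ← T_add,
      invert_T]
    rw [← Finset.sum_range_reflect]
    congr 1
    refine Finset.sum_congr rfl fun k hk => ?_
    rw [Finset.mem_range] at hk
    congr 1
    omega

open LaurentPolynomial in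
lemma det_laurentCartan_ne_zero : (laurentCartan b).det ≠ 0 := by
  have h0 : (deformedCartan b).det ≠ 0 := by
    intro h
    have h1 := isUnit_det_seriesCartan b
    have h2 := RingHom.map_det Polynomial.coeToPowerSeries.ringHom (deformedCartan b)
    rw [h, map_zero] at h2
    rw [seriesCartan, ← RingHom.mapMatrix_apply, ← h2] at h1
    exact not_isUnit_zero h1
  rw [laurentCartan, Matrix.det_mul, Matrix.det_diagonal, ← RingHom.map_det]
  exact mul_ne_zero (Polynomial.toLaurent_ne_zero.mpr h0)
    (Finset.prod_ne_zero_iff.mpr fun j _ => (isUnit_T _).ne_zero)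

open LaurentPolynomial in
/-- The numerator `diag(z^{d_i}) Q` over the ring of Laurent polynomials. -/
def laurentNum (Q : Matrix b.support b.support (Polynomial ℤ)) :
    Matrix b.support b.support ℤ[T;T⁻¹] :=
  Matrix.of fun i j => Polynomial.toLaurent (Polynomial.X ^ symmetrizerNat P i * Q i j)

open LaurentPolynomial in
lemma laurentCartan_mul
    (h : Q * deformedCartan b = 1 + (Polynomial.X ^ n : Polynomial ℤ) • starMatrix b _) :
    laurentCartan b * laurentNum Q = 1 + (T n : ℤ[T;T⁻¹]) • starMatrix b _ := by
  have h1 := congr(Polynomial.toLaurent.mapMatrix $(deformedCartan_mul h))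
  rw [coe_map_smul_starMatrix, map_mul, Polynomial.toLaurent_X, T_pow, mul_one] at h1
  rw [← h1, laurentCartan, mul_assoc]
  congr 1
  ext1 i j
  rw [Matrix.diagonal_mul, laurentNum, Matrix.of_apply, map_mul, Polynomial.toLaurent_X_pow,
    ← mul_assoc, ← T_add]
  simp

open LaurentPolynomial in
-- Inverting `z` in `C W = 1 + z^n σ` gives `C W(z⁻¹) = 1 + z^{-n} σ`. Multiplied by `z^n σ` the
-- right side becomes `1 + z^n σ` again because `σ² = 1`, and `C` can be cancelled.
lemma laurentNum_eq
    (h : Q * deformedCartan b = 1 + (Polynomial.X ^ n : Polynomial ℤ) • starMatrix b _) :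
    laurentNum Q = (T n : ℤ[T;T⁻¹]) • ((laurentNum Q).map invert * starMatrix b _) := by
  have h1 := congr((invert (R := ℤ) : ℤ[T;T⁻¹] →+* ℤ[T;T⁻¹]).mapMatrix $(laurentCartan_mul h))
  have h2 : (invert (R := ℤ) : ℤ[T;T⁻¹] →+* ℤ[T;T⁻¹]).mapMatrix (laurentCartan b) =
      laurentCartan b := by
    ext1 i j
    exact invert_laurentCartan i j
  have h3 : (invert (R := ℤ) : ℤ[T;T⁻¹] →+* ℤ[T;T⁻¹]).mapMatrix
      ((T n : ℤ[T;T⁻¹]) • starMatrix b _) = (T (-n) : ℤ[T;T⁻¹]) • starMatrix b _ := by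
    rw [← starMatrix_map (invert (R := ℤ) : ℤ[T;T⁻¹] →+* ℤ[T;T⁻¹])]
    ext1 i j
    simp only [starMatrix, RingHom.mapMatrix_apply, Matrix.map_apply, Matrix.smul_apply,
      Matrix.of_apply]
    split_ifs <;> simp
  rw [map_mul, map_add, map_one, h2, h3] at h1
  have h4 : laurentCartan b * (laurentNum Q -
      (T n : ℤ[T;T⁻¹]) • ((laurentNum Q).map invert * starMatrix b _)) = 0 := by
    rw [mul_sub, laurentCartan_mul h, Matrix.mul_smul, ← mul_assoc]
    change _ - (T n : ℤ[T;T⁻¹]) • (laurentCartan b * ((invert (R := ℤ) :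
      ℤ[T;T⁻¹] →+* ℤ[T;T⁻¹]).mapMatrix (laurentNum Q)) * _) = 0
    rw [h1, add_mul, one_mul, Matrix.smul_mul, starMatrix_mul_self, smul_add, smul_smul, ← T_add,
      add_neg_cancel, T_zero, one_smul, add_comm, sub_self]
  -- Over Laurent polynomials the determinant is nonzero but need not be a unit, so the adjugate
  -- stands in for the inverse.
  have h5 := congr((laurentCartan b).adjugate * $h4)
  rw [← mul_assoc, Matrix.adjugate_mul, Matrix.smul_mul, one_mul, mul_zero] at h5
  exact sub_eq_zero.mp ((smul_eq_zero.mp h5).resolve_left det_laurentCartan_ne_zero)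

open LaurentPolynomial in
lemma numCoeff_palindromic
    (h : Q * deformedCartan b = 1 + (Polynomial.X ^ n : Polynomial ℤ) • starMatrix b _)
    (i j : b.support) (u : ℤ) :
    numCoeff Q i j u = numCoeff Q i (starInvolution b j) (n - u) := by
  have h1 := congr($(laurentNum_eq h) i j)
  rw [Matrix.smul_apply, mul_starMatrix_apply, Matrix.map_apply, smul_eq_mul] at h1
  have h2 := congr(($h1).coeff u)
  have h3 : (T n * invert (laurentNum Q i (starInvolution b j))).coeff u =
      (laurentNum Q i (starInvolution b j)).coeff (n - u) := by
    rw [T, show u = (n : ℤ) + (u - n) by ring, AddMonoidAlgebra.coeff_single_mul_add]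
    rw [one_mul, invert_apply]
    congr 1
    ring
  rw [h3] at h2
  rw [numCoeff, numCoeff]
  exact congr(($h2 : ℚ))

variable (b) in
theorem exists_isQuasiPeriodic [Nonempty b.support] :
    ∃ W, IsQuasiPeriodic (starInvolution b) (fun i => symmetrizer P i) (rTimesDualCoxeter b)
      (invCoeff b) W := by
  obtain ⟨n, hn, Q, hQ, hQA⟩ := exists_mul_deformedCartan b
  have hne : Nonempty ι := ⟨(Classical.arbitrary b.support : b.support)⟩
  have hcard : 0 < Fintype.card b.support := Fintype.card_pos
  -- Both numbers, multiplied by the rank, equal the sum of `d` over all roots.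
  have hn' : rTimesDualCoxeter b = n := by
    have h := sum_symmetrizerNat b
    rw [← hn, Nat.cast_mul, mul_comm] at h
    exact (mul_left_cancel₀ (by exact_mod_cast hcard.ne') h).symm
  have hpos : 0 < n := by
    have h : 0 < n * Fintype.card b.support := by
      rw [hn]
      exact Finset.sum_pos (fun k _ => symmetrizerNat_pos k) Finset.univ_nonempty
    exact Nat.pos_of_mul_pos_right h
  rw [hn']
  refine ⟨numCoeff Q, starInvolution_starInvolution b, fun i => symmetrizer_pos _,
    by exact_mod_cast hpos, numCoeff_eq_add hQA, numCoeff_palindromic hQA, numCoeff_nonneg hQ,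
    fun i j u hu => invCoeff_of_lt b i j (by rwa [symmetrizerNat_cast]), fun i j => ?_⟩
  rw [← symmetrizerNat_cast, invCoeff_symmetrizerNat]

end Numerator

end

end QuantumCartan

/-! ### The root system of a simple Lie algebra -/

theorem mainTheorem5 {𝔤 : Type*} [LieRing 𝔤] [LieAlgebra ℂ 𝔤] [FiniteDimensional ℂ 𝔤]
    [LieAlgebra.IsSimple ℂ 𝔤] (H : LieSubalgebra ℂ 𝔤) [H.IsCartanSubalgebra]
    (b : (LieAlgebra.IsKilling.rootSystem H).Base) :
    -- `C(z)` is invertible with inverse `C̃(z)`, and the numbers `c̃_ij(u)` are integers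
    (∀ i j : b.support,
      (quantumCartan b * invQuantumCartan b) i j = (kroneckerDelta i j : RatFunc ℚ)) ∧
    (∀ (i j : b.support) (u : ℤ), ∃ m : ℤ, invCoeff b i j u = m) ∧
    -- shift by `r h^∨`
    (∀ (i j : b.support) (u : ℤ), 0 ≤ u →
      invCoeff b i j (u + rTimesDualCoxeter b) = -invCoeff b i (starInvolution b j) u) ∧
    -- shift by `2 r h^∨`
    (∀ (i j : b.support) (u : ℤ), 0 ≤ u →
      invCoeff b i j (u + 2 * rTimesDualCoxeter b) = invCoeff b i j u) ∧
    -- reflections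
    (∀ (i j : b.support) (u : ℤ), 0 ≤ u → u ≤ rTimesDualCoxeter b →
      invCoeff b i j (rTimesDualCoxeter b - u) = invCoeff b i (starInvolution b j) u) ∧
    (∀ (i j : b.support) (u : ℤ), 0 ≤ u → u ≤ 2 * rTimesDualCoxeter b →
      invCoeff b i j (2 * rTimesDualCoxeter b - u) = -invCoeff b i j u) ∧
    -- vanishing near the multiples of `r h^∨`
    (∀ (i j : b.support) (u : ℤ),
      (∃ k : ℕ, |u - k * rTimesDualCoxeter b| ≤
        symmetrizer (LieAlgebra.IsKilling.rootSystem H) i -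
          kroneckerDelta i ((starInvolution b)^[k] j)) →
      invCoeff b i j u = 0) ∧
    -- signs
    (∀ (i j : b.support) (u : ℤ), 0 ≤ u → u ≤ rTimesDualCoxeter b →
      0 ≤ invCoeff b i j u) ∧
    (∀ (i j : b.support) (u : ℤ), rTimesDualCoxeter b ≤ u → u ≤ 2 * rTimesDualCoxeter b →
      invCoeff b i j u ≤ 0) := by
  -- Each claim supplies a simple root, which provides the nonemptiness required.
  have key : ∀ _ : b.support, ∃ W, IsQuasiPeriodic (starInvolution b)
      (fun i : b.support => symmetrizer (LieAlgebra.IsKilling.rootSystem H) i)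
      (rTimesDualCoxeter b) (invCoeff b) W := fun i =>
    haveI : Nonempty b.support := ⟨i⟩
    exists_isQuasiPeriodic b
  refine ⟨quantumCartan_mul_inv_apply b, fun i j u => ⟨_, invCoeff_eq b i j u⟩, fun i j u hu => ?_,
    fun i j u hu => ?_, fun i j u hu hu' => ?_, fun i j u hu hu' => ?_, fun i j u hu => ?_,
    fun i j u _ hu => ?_, fun i j u hu hu' => ?_⟩
  all_goals obtain ⟨W, h⟩ := key i
  · exact h.shift i j hu
  · exact h.shift_two i j hu
  · exact h.reflect i j hu hu'
  · exact h.reflect_two i j hu hu'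
  · obtain ⟨k, hk⟩ := hu
    exact h.vanishing i j k hk
  · exact h.coeff_nonneg i j hu
  · exact h.coeff_nonpos i j hu hu'
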